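/- Theorem 1. Let $A\in\mathbb{R}^{m\times n}$, $b\in\mathbb{R}^m$, $1\le k<\operatorname{rank}(A)=\rho$ and $0<\varepsilon<1/2$. Let $A=U\Sigma V^{T}$ be any compact singular value decomposition ($U\in\mathbb{R}^{m\times\rho}$ and $V\in\mathbb{R}^{n\times\rho}$ with orthonormal columns, $\Sigma=\operatorname{diag}(\sigma_1(A)\ge\dots\ge\sigma_\rho(A)>0)$), let $U_k,V_k$ be the first $k$ columns of $U,V$, $\Sigma_k=\operatorname{diag}(\sigma_1(A),\dots,\sigma_k(A))$, $A_k=U_k\Sigma_kV_k^{T}$, $E=A-AV_kV_k^{T}=A-A_k$, and let $M^+$ denote the Moore–Penrose pseudo-inverse. Put $r=\lceil 9k/\varepsilon^2\rceil$. DeterministicSampling$(V_k^{T},E,r)$: let $v_i$, $e_i$ be the $i$-th columns of $V_k^{T}$ and $E$, and for symmetric $B\in\mathbb{R}^{k\times k}$ with eigenvalues $\lambda_1,\dots,\lambda_k$ put $$\phi(l,B)=\sum_{j=1}^k\frac1{\lambda_j-l},\qquad L(v,B,l)=\frac{v^{T}(B-(l+1)I)^{-2}v}{\phi(l+1,B)-\phi(l,B)}-v^{T}(B-(l+1)I)^{-1}v,\qquad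 U(e)=\frac{e^{T}e}{\|E\|_F^2}\Bigl(1-\sqrt{k/r}\Bigr).$$ Start with $B_0=0$, $\Omega=0\in\mathbb{R}^{n\times r}$, $S=0\in\mathbb{R}^{r\times r}$. For $\tau=0,\dots,r-1$ pick any index $i$ and any $t>0$ with $U(e_i)\le 1/t\le L(v_i,B_\tau,\tau-\sqrt{rk})$, and set $B_{\tau+1}=B_\tau+t\,v_iv_i^{T}$, $\Omega_{i,\tau+1}=1$, $S_{\tau+1,\tau+1}=1/\sqrt t$. Return $\Omega,S$. Algorithm 1 takes $\Omega,S$ from DeterministicSampling$(V_k^{T},E,r)$, forms $C=A\Omega S$ and returns $\hat x_r=\Omega S\,C^+b\in\mathbb{R}^n$. Then: (1) The algorithm never gets stuck: after any admissible choices in the first $\tau<r$ steps an admissible pair $(i,t)$ exists for the next step; so an output exists. Every possible output $\hat x_r$ has at most $r=\lceil 9k/\varepsilon^2\rceil$ nonzero entries and satisfies $$\|A\hat x_r-b\|_2\le\|Ax_k^*-b\|_2+(1+\varepsilon)\,\|b\|_2\,\frac{\|A-A_k\|_F}{\sigma_k(A)},\qquad x_k^*=A_k^+b.$$ (2) The algorithm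 runs in time $O(mn\min\{m,n\}+nk^3/\varepsilon^2)$: there are one program for the real random access machine and one absolute constant $c$ such that, on every input $A,b,k,\varepsilon$ as above, the program halts after at most $c\,(mn\min\{m,n\}+nk^3/\varepsilon^2)$ steps with a possible output $\hat x_r$ of Algorithm 1. Here the arithmetic operations and square roots on reals, comparisons, additions and subtractions of natural numbers, and indexed memory accesses cost one step each, and a compact singular value decomposition of a $p\times q$ matrix is a primitive operation, returning an arbitrary fixed choice of decomposition for each matrix, that costs $pq\min\{p,q\}$ steps. -/

import Mathlib

open Matrix

namespace SparseRegression

/-- The Frobenius norm of a real matrix. -/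
noncomputable def frobNorm {m n : ℕ} (M : Matrix (Fin m) (Fin n) ℝ) : ℝ :=
  √(∑ i, ∑ j, M i j ^ 2)

/-- The Euclidean norm of a real vector. -/
noncomputable def l2norm {m : ℕ} (v : Fin m → ℝ) : ℝ := ‖WithLp.toLp 2 v‖

/-! ### The singular value decomposition and the pseudo-inverse -/

/-- A compact (thin) singular value decomposition `A = U Σ Vᵀ`, with `rank A` positive singular
values in decreasing order. It need not be unique. -/
structure CompactSVD {m n : ℕ} (A : Matrix (Fin m) (Fin n) ℝ) where
  U : Matrix (Fin m) (Fin A.rank) ℝ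
  s : Fin A.rank → ℝ
  V : Matrix (Fin n) (Fin A.rank) ℝ
  U_orth : Uᵀ * U = 1
  V_orth : Vᵀ * V = 1
  s_pos : ∀ j, 0 < s j
  s_anti : Antitone s
  eq : A = U * diagonal s * Vᵀ

/-- Every real matrix has a compact singular value decomposition. -/
theorem exists_compactSVD {m n : ℕ} (A : Matrix (Fin m) (Fin n) ℝ) :
    Nonempty (CompactSVD A) := by
  have hps : (Aᵀ * A).PosSemidef := by
    simpa using posSemidef_conjTranspose_mul_self A
  set hH := hps.1
  set p := Tuple.sort (fun i => - hH.eigenvalues i)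
  set l : Fin n → ℝ := fun j => hH.eigenvalues (p j) with hl
  set W : Matrix (Fin n) (Fin n) ℝ :=
    Matrix.of fun i j => hH.eigenvectorBasis (p j) i with hW
  have hl0 : ∀ j, 0 ≤ l j := fun j => hps.eigenvalues_nonneg _
  have hlanti : Antitone l := by
    intro i j hij
    have := Tuple.monotone_sort (fun i => - hH.eigenvalues i) hij
    simpa using this
  have hWW : Wᵀ * W = 1 := by
    ext i j
    have := hH.eigenvectorBasis.inner_eq_ite (p i) (p j)
    rw [PiLp.inner_apply] at this
    simp only [mul_apply, transpose_apply, hW, of_apply, one_apply]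
    simpa [mul_comm] using this
  have hWW' : W * Wᵀ = 1 := mul_eq_one_comm.mp hWW
  have hHW : Aᵀ * A * W = W * diagonal l := by
    ext i j
    have := congrFun (hH.mulVec_eigenvectorBasis (p j)) i
    rw [mul_diagonal, mul_comm (W i j)]
    simpa [mulVec, dotProduct, mul_apply, hW, hl] using this
  have hAW : (A * W)ᵀ * (A * W) = diagonal l := by
    rw [transpose_mul, Matrix.mul_assoc, ← Matrix.mul_assoc Aᵀ, hHW, ← Matrix.mul_assoc, hWW,
      Matrix.one_mul]
  have hcard : (Finset.univ.filter fun j => l j ≠ 0).card = A.rank := by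
    rw [← rank_transpose_mul_self A, hH.rank_eq_card_non_zero_eigs, Fintype.card_subtype]
    refine Finset.card_bij (fun j _ => p j) ?_ ?_ ?_
    · intro a ha; simpa [hl] using ha
    · intro a _ b _ h; exact p.injective h
    · intro b hb; exact ⟨p.symm b, by simpa [hl] using hb, by simp⟩
  have hpos : ∀ j : Fin n, (j : ℕ) < A.rank → 0 < l j := by
    intro j hj
    refine lt_of_le_of_ne (hl0 j) fun h0 => ?_
    have hsub : (Finset.univ.filter fun j => l j ≠ 0) ⊆ Finset.Iio j := by
      intro i hi
      rw [Finset.mem_filter] at hi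
      rw [Finset.mem_Iio]
      by_contra hc
      exact hi.2 (le_antisymm (h0 ▸ hlanti (not_lt.mp hc)) (hl0 i))
    have := Finset.card_le_card hsub
    rw [hcard, Fin.card_Iio] at this
    omega
  have hzero : ∀ j : Fin n, A.rank ≤ (j : ℕ) → l j = 0 := by
    intro j hj
    by_contra h0
    have hsub : Finset.Iic j ⊆ (Finset.univ.filter fun j => l j ≠ 0) := by
      intro i hi
      rw [Finset.mem_Iic] at hi
      rw [Finset.mem_filter]
      exact ⟨Finset.mem_univ _, (lt_of_lt_of_le (lt_of_le_of_ne (hl0 j) (Ne.symm h0))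
        (hlanti hi)).ne'⟩
    have := Finset.card_le_card hsub
    rw [hcard, Fin.card_Iic] at this
    omega
  have hAW0 : ∀ j : Fin n, A.rank ≤ (j : ℕ) → ∀ i, (A * W) i j = 0 := by
    intro j hj i
    have h1 := congrFun (congrFun hAW j) j
    rw [diagonal_apply_eq, hzero j hj, mul_apply] at h1
    have h2 := (Finset.sum_eq_zero_iff_of_nonneg (fun x _ => by
      rw [transpose_apply]; exact mul_self_nonneg _)).mp h1 i (Finset.mem_univ _)
    rw [transpose_apply] at h2
    exact mul_self_eq_zero.mp h2
  have hr : A.rank ≤ n := by simpa using A.rank_le_width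
  set c : Fin A.rank → Fin n := Fin.castLE hr with hc
  have hcinj : Function.Injective c := Fin.castLE_injective hr
  have hlc : ∀ j, 0 < l (c j) := fun j => hpos _ j.2
  refine ⟨⟨Matrix.of fun i j => (A * W) i (c j) / √(l (c j)), fun j => √(l (c j)),
    Matrix.of fun i j => W i (c j),
    ?_, ?_, fun j => Real.sqrt_pos.mpr (hlc j),
    fun i j hij => Real.sqrt_le_sqrt (hlanti (by simpa [hc] using hij)), ?_⟩⟩
  · ext i j
    have h1 := congrFun (congrFun hAW (c i)) (c j)
    have h2 : (∑ x, (A * W) x (c i) / √(l (c i)) * ((A * W) x (c j) / √(l (c j)))) =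
        (∑ x, (A * W)ᵀ (c i) x * (A * W) x (c j)) / (√(l (c i)) * √(l (c j))) := by
      rw [Finset.sum_div]
      exact Finset.sum_congr rfl fun x _ => by rw [transpose_apply, div_mul_div_comm]
    rw [mul_apply] at h1 ⊢
    simp only [transpose_apply, of_apply] at h1 h2 ⊢
    rw [h2, h1]
    by_cases hij : i = j
    · subst hij
      rw [diagonal_apply_eq, one_apply_eq, Real.mul_self_sqrt (hl0 _), div_self (hlc _).ne']
    · rw [diagonal_apply_ne _ (fun h => hij (hcinj h)), one_apply_ne hij, zero_div]
  · ext i j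
    have h1 := congrFun (congrFun hWW (c i)) (c j)
    rw [mul_apply] at h1 ⊢
    simp only [transpose_apply, of_apply] at h1 ⊢
    rw [h1, one_apply, one_apply]
    simp only [hcinj.eq_iff]
  · have hA : A = A * W * Wᵀ := by rw [Matrix.mul_assoc, hWW', Matrix.mul_one]
    ext a b
    have h1 := congrFun (congrFun hA a) b
    rw [mul_apply] at h1
    rw [h1, mul_apply]
    simp only [mul_diagonal, transpose_apply, of_apply]
    symm
    calc ∑ j, (A * W) a (c j) / √(l (c j)) * √(l (c j)) * W b (c j)
        = ∑ j, (A * W) a (c j) * W b (c j) := Finset.sum_congr rfl fun j _ => by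
          rw [div_mul_cancel₀ _ (Real.sqrt_pos.mpr (hlc j)).ne']
      _ = ∑ j ∈ Finset.univ.map ⟨c, hcinj⟩, (A * W) a j * W b j := by
          rw [Finset.sum_map]; rfl
      _ = ∑ j, (A * W) a j * W b j := by
          refine Finset.sum_subset (Finset.subset_univ _) fun j _ hj => ?_
          have : A.rank ≤ (j : ℕ) := by
            by_contra hlt
            push Not at hlt
            exact hj (Finset.mem_map.mpr ⟨⟨j, hlt⟩, Finset.mem_univ _, Fin.ext rfl⟩)
          rw [hAW0 j this a, zero_mul]

namespace CompactSVD

variable {m n : ℕ} {A : Matrix (Fin m) (Fin n) ℝ}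

/-- `V Σ⁻¹ Uᵀ`. -/
noncomputable def pinv (D : CompactSVD A) : Matrix (Fin n) (Fin m) ℝ :=
  D.V * diagonal (fun j => (D.s j)⁻¹) * D.Uᵀ

/-- The first `k` left singular vectors. -/
noncomputable def Uk (D : CompactSVD A) {k : ℕ} (hk : k ≤ A.rank) : Matrix (Fin m) (Fin k) ℝ :=
  D.U.submatrix id (Fin.castLE hk)

/-- The `k` largest singular values. -/
noncomputable def sk (D : CompactSVD A) {k : ℕ} (hk : k ≤ A.rank) : Fin k → ℝ :=
  fun j => D.s (Fin.castLE hk j)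

/-- The first `k` right singular vectors. -/
noncomputable def Vk (D : CompactSVD A) {k : ℕ} (hk : k ≤ A.rank) : Matrix (Fin n) (Fin k) ℝ :=
  D.V.submatrix id (Fin.castLE hk)

/-- The truncation `A_k = U_k Σ_k V_kᵀ`. -/
noncomputable def Ak (D : CompactSVD A) {k : ℕ} (hk : k ≤ A.rank) : Matrix (Fin m) (Fin n) ℝ :=
  D.Uk hk * diagonal (D.sk hk) * (D.Vk hk)ᵀ

theorem mul_pinv (D : CompactSVD A) : A * D.pinv = D.U * D.Uᵀ := by
  calc A * D.pinv = D.U * diagonal D.s * D.Vᵀ * D.pinv := congrArg (· * D.pinv) D.eq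
    _ = D.U * diagonal D.s * D.Vᵀ * (D.V * diagonal (fun j => (D.s j)⁻¹) * D.Uᵀ) := rfl
    _ = D.U * diagonal D.s * (D.Vᵀ * D.V) * diagonal (fun j => (D.s j)⁻¹) * D.Uᵀ := by
        simp only [Matrix.mul_assoc]
    _ = D.U * (diagonal D.s * diagonal (fun j => (D.s j)⁻¹)) * D.Uᵀ := by
        rw [D.V_orth, Matrix.mul_one]; simp only [Matrix.mul_assoc]
    _ = D.U * D.Uᵀ := by
        rw [diagonal_mul_diagonal]
        simp [mul_inv_cancel₀ (D.s_pos _).ne']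

theorem pinv_mul (D : CompactSVD A) : D.pinv * A = D.V * D.Vᵀ := by
  calc D.pinv * A = D.pinv * (D.U * diagonal D.s * D.Vᵀ) := congrArg (D.pinv * ·) D.eq
    _ = D.V * diagonal (fun j => (D.s j)⁻¹) * D.Uᵀ * (D.U * diagonal D.s * D.Vᵀ) := rfl
    _ = D.V * diagonal (fun j => (D.s j)⁻¹) * (D.Uᵀ * D.U) * diagonal D.s * D.Vᵀ := by
        simp only [Matrix.mul_assoc]
    _ = D.V * (diagonal (fun j => (D.s j)⁻¹) * diagonal D.s) * D.Vᵀ := by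
        rw [D.U_orth, Matrix.mul_one]; simp only [Matrix.mul_assoc]
    _ = D.V * D.Vᵀ := by
        rw [diagonal_mul_diagonal]
        simp [inv_mul_cancel₀ (D.s_pos _).ne']

theorem mul_pinv_mul (D : CompactSVD A) : A * D.pinv * A = A := by
  calc A * D.pinv * A = D.U * D.Uᵀ * (D.U * diagonal D.s * D.Vᵀ) := by
        rw [D.mul_pinv]; exact congrArg (D.U * D.Uᵀ * ·) D.eq
    _ = D.U * diagonal D.s * D.Vᵀ := by
        rw [← Matrix.mul_assoc, ← Matrix.mul_assoc, Matrix.mul_assoc D.U, D.U_orth, Matrix.mul_one]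
    _ = A := D.eq.symm

theorem pinv_mul_pinv (D : CompactSVD A) : D.pinv * A * D.pinv = D.pinv := by
  rw [D.pinv_mul]
  unfold pinv
  rw [← Matrix.mul_assoc, ← Matrix.mul_assoc, Matrix.mul_assoc D.V, D.V_orth, Matrix.mul_one]

/-- `V Σ⁻¹ Uᵀ` does not depend on the decomposition. -/
theorem pinv_unique (D D' : CompactSVD A) : D.pinv = D'.pinv := by
  have h1 : A * D.pinv = A * D'.pinv := by
    have hs : ∀ F : CompactSVD A, (A * F.pinv)ᵀ = A * F.pinv := fun F => by
      rw [F.mul_pinv, transpose_mul, transpose_transpose]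
    calc A * D.pinv = (A * D'.pinv * A * D.pinv)ᵀ := by rw [D'.mul_pinv_mul, hs]
      _ = A * D.pinv * (A * D'.pinv) := by
        rw [Matrix.mul_assoc (A * D'.pinv), transpose_mul, hs, hs]
      _ = A * D'.pinv := by rw [← Matrix.mul_assoc, D.mul_pinv_mul]
  have h2 : D.pinv * A = D'.pinv * A := by
    have hs : ∀ F : CompactSVD A, (F.pinv * A)ᵀ = F.pinv * A := fun F => by
      rw [F.pinv_mul, transpose_mul, transpose_transpose]
    calc D.pinv * A = (D.pinv * A * (D'.pinv * A))ᵀ := by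
          rw [Matrix.mul_assoc, ← Matrix.mul_assoc A, D'.mul_pinv_mul, hs]
      _ = D'.pinv * A * (D.pinv * A) := by rw [transpose_mul, hs, hs]
      _ = D'.pinv * A := by rw [Matrix.mul_assoc, ← Matrix.mul_assoc A, D.mul_pinv_mul]
  calc D.pinv = D.pinv * A * D.pinv := D.pinv_mul_pinv.symm
    _ = D'.pinv * A * D'.pinv := by rw [Matrix.mul_assoc, h1, ← Matrix.mul_assoc, h2]
    _ = D'.pinv := D'.pinv_mul_pinv

end CompactSVD

/-- The Moore-Penrose pseudo-inverse `A⁺ = V Σ⁻¹ Uᵀ`. -/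
noncomputable def pinv {m n : ℕ} (A : Matrix (Fin m) (Fin n) ℝ) : Matrix (Fin n) (Fin m) ℝ :=
  (Classical.choice (exists_compactSVD A)).pinv

/-- The pseudo-inverse can be read off from any compact singular value decomposition. -/
theorem pinv_eq {m n : ℕ} {A : Matrix (Fin m) (Fin n) ℝ} (D : CompactSVD A) : pinv A = D.pinv :=
  CompactSVD.pinv_unique _ _

/-! ### Deterministic sampling -/

/-- `φ(l, B) = ∑ᵢ 1 / (λᵢ - l)`, over the eigenvalues `λᵢ` of the symmetric matrix `B`, with
multiplicity. -/
noncomputable def phi {k : ℕ} (l : ℝ) (B : Matrix (Fin k) (Fin k) ℝ) : ℝ :=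
  (B.charpoly.roots.map fun x => 1 / (x - l)).sum

/-- `L(v, B, l)`, with `l' = l + 1`. -/
noncomputable def lowerL {k : ℕ} (v : Fin k → ℝ) (B : Matrix (Fin k) (Fin k) ℝ) (l : ℝ) : ℝ :=
  v ⬝ᵥ (((B - (l + 1) • (1 : Matrix (Fin k) (Fin k) ℝ))⁻¹ ^ 2) *ᵥ v) / (phi (l + 1) B - phi l B)
    - v ⬝ᵥ ((B - (l + 1) • (1 : Matrix (Fin k) (Fin k) ℝ))⁻¹ *ᵥ v)

/-- `U(e) = (eᵀe / ‖E‖_F²) (1 - √(k / r))`. -/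
noncomputable def upperU {m n : ℕ} (E : Matrix (Fin m) (Fin n) ℝ) (k r : ℕ) (e : Fin m → ℝ) : ℝ :=
  e ⬝ᵥ e / frobNorm E ^ 2 * (1 - √((k : ℝ) / r))

/-- `l_τ = τ - √(r k)`. -/
noncomputable def barrier (k r τ : ℕ) : ℝ := (τ : ℝ) - √((r : ℝ) * k)

/-- The matrix `B_τ` after the first `τ` choices of an index `i` and a weight `t`:
`B_0 = 0` and `B_{τ+1} = B_τ + t v_i v_iᵀ`. -/
def accum {k n : ℕ} (Vt : Matrix (Fin k) (Fin n) ℝ) (i : ℕ → Fin n) (t : ℕ → ℝ) :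
    ℕ → Matrix (Fin k) (Fin k) ℝ
  | 0 => 0
  | τ + 1 => accum Vt i t τ + t τ • vecMulVec (Vt.col (i τ)) (Vt.col (i τ))

/-- The index `i` and the weight `t > 0` may be picked at step `τ` when `B_τ = B`:
`U(e_i) ≤ 1 / t ≤ L(v_i, B, l_τ)`. -/
def Admissible {k m n : ℕ} (Vt : Matrix (Fin k) (Fin n) ℝ) (E : Matrix (Fin m) (Fin n) ℝ) (r : ℕ)
    (B : Matrix (Fin k) (Fin k) ℝ) (τ : ℕ) (i : Fin n) (t : ℝ) : Prop :=
  0 < t ∧ upperU E k r (E.col i) ≤ 1 / t ∧ 1 / t ≤ lowerL (Vt.col i) B (barrier k r τ)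

/-- The first `N` steps of the sampling procedure may make the choices `i`, `t`. -/
def SamplingSteps {k m n : ℕ} (Vt : Matrix (Fin k) (Fin n) ℝ) (E : Matrix (Fin m) (Fin n) ℝ)
    (r N : ℕ) (i : ℕ → Fin n) (t : ℕ → ℝ) : Prop :=
  ∀ τ < N, Admissible Vt E r (accum Vt i t τ) τ (i τ) (t τ)

/-- `Ω_{i, τ} = 1` if `i` is the index picked at step `τ`, all other entries are `0`. -/
def samplingMatrix {n : ℕ} (r : ℕ) (i : ℕ → Fin n) : Matrix (Fin n) (Fin r) ℝ :=
  Matrix.of fun j τ => if j = i τ then 1 else 0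

/-- The diagonal matrix `S` with `S_{τ, τ} = 1 / √t`, where `t` is picked at step `τ`. -/
noncomputable def rescalingMatrix (r : ℕ) (t : ℕ → ℝ) : Matrix (Fin r) (Fin r) ℝ :=
  diagonal fun τ => 1 / √(t τ)

/-- `Ω`, `S` may be returned by `DeterministicSampling (Vt, E, r)`. -/
def IsDeterministicSampling {k m n : ℕ} (Vt : Matrix (Fin k) (Fin n) ℝ)
    (E : Matrix (Fin m) (Fin n) ℝ) (r : ℕ) (Ω : Matrix (Fin n) (Fin r) ℝ)
    (S : Matrix (Fin r) (Fin r) ℝ) : Prop :=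
  ∃ (i : ℕ → Fin n) (t : ℕ → ℝ), SamplingSteps Vt E r r i t ∧
    Ω = samplingMatrix r i ∧ S = rescalingMatrix r t

/-! ### Deterministic sparse regression -/

/-- `r = ⌈9 k / ε²⌉`. -/
noncomputable def numCols (k : ℕ) (ε : ℝ) : ℕ := ⌈9 * (k : ℝ) / ε ^ 2⌉₊

/-- `E = A - A V_k V_kᵀ`. -/
noncomputable def residualMatrix {m n : ℕ} {A : Matrix (Fin m) (Fin n) ℝ} (D : CompactSVD A) {k : ℕ}
    (hk : k ≤ A.rank) : Matrix (Fin m) (Fin n) ℝ :=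
  A - A * D.Vk hk * (D.Vk hk)ᵀ

/-- `x` may be returned by the sparse regression algorithm on input `A`, `b`, `k`, `ε`, if it uses
the singular value decomposition `D` of `A`. -/
def IsSparseRegressionOutput {m n : ℕ} {A : Matrix (Fin m) (Fin n) ℝ} (D : CompactSVD A)
    (b : Fin m → ℝ) {k : ℕ} (hk : k ≤ A.rank) (ε : ℝ) (x : Fin n → ℝ) : Prop :=
  ∃ (Ω : Matrix (Fin n) (Fin (numCols k ε)) ℝ)
    (S : Matrix (Fin (numCols k ε)) (Fin (numCols k ε)) ℝ),
    IsDeterministicSampling (D.Vk hk)ᵀ (residualMatrix D hk) (numCols k ε) Ω S ∧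
      x = (Ω * S) *ᵥ (pinv (A * Ω * S) *ᵥ b)

/-! ### A real random access machine

Programs of a small imperative language act on natural-number registers (for sizes and indices),
real registers and two-dimensional real arrays. Every elementary operation costs one step. The
singular value decomposition of a `p × q` matrix, which finitely many arithmetic operations cannot
compute exactly, is a primitive that costs `p q min(p, q)` steps. -/

/-- A routine that computes singular value decompositions. -/
abbrev SVDRoutine : Type :=
  ∀ (p q : ℕ) (M : Matrix (Fin p) (Fin q) ℝ), CompactSVD M

/-- The memory. -/
structure Store where
  nat : ℕ → ℕ
  real : ℕ → ℝ
  arr : ℕ → ℕ → ℕ → ℝ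

/-- Natural-number expressions. -/
inductive NatExp where
  | lit (c : ℕ)
  | var (x : ℕ)
  | add (a b : NatExp)
  | sub (a b : NatExp)

namespace NatExp

/-- The value of an expression; subtraction is truncated. -/
def eval (st : Store) : NatExp → ℕ
  | lit c => c
  | var x => st.nat x
  | add a b => a.eval st + b.eval st
  | sub a b => a.eval st - b.eval st

/-- The number of steps of an evaluation. -/
def cost : NatExp → ℕ
  | lit _ => 1
  | var _ => 1
  | add a b => a.cost + b.cost + 1
  | sub a b => a.cost + b.cost + 1

end NatExp

/-- Real expressions. -/
inductive RealExp where
  | ofNat (a : NatExp)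
  | var (x : ℕ)
  | entry (a : ℕ) (i j : NatExp)
  | add (x y : RealExp)
  | sub (x y : RealExp)
  | mul (x y : RealExp)
  | div (x y : RealExp)
  | sqrt (x : RealExp)

namespace RealExp

/-- The value of an expression; `x / 0` and the square root of a negative number are `0`. -/
noncomputable def eval (st : Store) : RealExp → ℝ
  | ofNat a => (a.eval st : ℝ)
  | var x => st.real x
  | entry a i j => st.arr a (i.eval st) (j.eval st)
  | add x y => x.eval st + y.eval st
  | sub x y => x.eval st - y.eval st
  | mul x y => x.eval st * y.eval st
  | div x y => x.eval st / y.eval st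
  | sqrt x => √(x.eval st)

/-- The number of steps of an evaluation. -/
def cost : RealExp → ℕ
  | ofNat a => a.cost + 1
  | var _ => 1
  | entry _ i j => i.cost + j.cost + 1
  | add x y => x.cost + y.cost + 1
  | sub x y => x.cost + y.cost + 1
  | mul x y => x.cost + y.cost + 1
  | div x y => x.cost + y.cost + 1
  | sqrt x => x.cost + 1

end RealExp

/-- Comparisons. -/
inductive Test where
  | natLt (a b : NatExp)
  | realLt (x y : RealExp)
  | not (c : Test)

namespace Test

/-- The comparison succeeds. -/
def Holds (st : Store) : Test → Prop
  | natLt a b => a.eval st < b.eval st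
  | realLt x y => x.eval st < y.eval st
  | not c => ¬ c.Holds st

/-- The number of steps of a comparison. -/
def cost : Test → ℕ
  | natLt a b => a.cost + b.cost + 1
  | realLt x y => x.cost + y.cost + 1
  | not c => c.cost + 1

end Test

/-- Programs. `svd p q a u s v ρ` decomposes the `p × q` matrix in the array `a`; it writes the
left singular vectors into the array `u`, the singular values into row `0` of the array `s`, the
right singular vectors into the array `v`, and the rank into the register `ρ`. -/
inductive Cmd where
  | skip
  | setNat (x : ℕ) (e : NatExp)
  | setReal (x : ℕ) (e : RealExp)
  | setEntry (a : ℕ) (i j : NatExp) (e : RealExp)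
  | svd (p q : NatExp) (a u s v ρ : ℕ)
  | seq (c d : Cmd)
  | ite (b : Test) (c d : Cmd)
  | while (b : Test) (c : Cmd)

/-- The `p × q` matrix in the upper left corner of the array `f`. -/
def readBlock (f : ℕ → ℕ → ℝ) (p q : ℕ) : Matrix (Fin p) (Fin q) ℝ :=
  Matrix.of fun i j => f i j

/-- The array `f` with its upper left corner overwritten by the matrix `M`. -/
def writeBlock (f : ℕ → ℕ → ℝ) {p q : ℕ} (M : Matrix (Fin p) (Fin q) ℝ) : ℕ → ℕ → ℝ :=
  fun i j => if h : i < p ∧ j < q then M ⟨i, h.1⟩ ⟨j, h.2⟩ else f i j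

namespace Store

/-- Overwrite the register `x`. -/
def setNat (st : Store) (x c : ℕ) : Store := { st with nat := Function.update st.nat x c }

/-- Overwrite the real register `x`. -/
def setReal (st : Store) (x : ℕ) (c : ℝ) : Store :=
  { st with real := Function.update st.real x c }

/-- Overwrite one entry of the array `a`. -/
def setEntry (st : Store) (a i j : ℕ) (c : ℝ) : Store :=
  let rows := Function.update (st.arr a) i (Function.update (st.arr a i) j c)
  { st with arr := Function.update st.arr a rows }

/-- Overwrite the upper left corner of the array `a`. -/
def setBlock (st : Store) (a : ℕ) {p q : ℕ} (M : Matrix (Fin p) (Fin q) ℝ) : Store :=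
  { st with arr := Function.update st.arr a (writeBlock (st.arr a) M) }

/-- Write a singular value decomposition into the memory. -/
noncomputable def setSVD (st : Store) (u s v ρ : ℕ) {p q : ℕ} {M : Matrix (Fin p) (Fin q) ℝ}
    (D : CompactSVD M) : Store :=
  (((st.setBlock u D.U).setBlock s (Matrix.of fun (_ : Fin 1) j => D.s j)).setBlock v D.V).setNat
    ρ M.rank

end Store

/-- `Exec svd c st st' T`: started in the memory `st`, the program `c` halts after `T` steps with
the memory `st'`. -/
inductive Exec (svd : SVDRoutine) : Cmd → Store → Store → ℕ → Prop
  | skip (st : Store) : Exec svd .skip st st 1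
  | setNat (st : Store) (x : ℕ) (e : NatExp) :
      Exec svd (.setNat x e) st (st.setNat x (e.eval st)) (e.cost + 1)
  | setReal (st : Store) (x : ℕ) (e : RealExp) :
      Exec svd (.setReal x e) st (st.setReal x (e.eval st)) (e.cost + 1)
  | setEntry (st : Store) (a : ℕ) (i j : NatExp) (e : RealExp) :
      Exec svd (.setEntry a i j e) st (st.setEntry a (i.eval st) (j.eval st) (e.eval st))
        (i.cost + j.cost + e.cost + 1)
  | svd (st : Store) (p q : NatExp) (a u s v ρ : ℕ) :
      Exec svd (.svd p q a u s v ρ) st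
        (st.setSVD u s v ρ
          (svd (p.eval st) (q.eval st) (readBlock (st.arr a) (p.eval st) (q.eval st))))
        (p.cost + q.cost + p.eval st * q.eval st * min (p.eval st) (q.eval st) + 1)
  | seq (c d : Cmd) (st₀ st₁ st₂ : Store) (T₁ T₂ : ℕ) :
      Exec svd c st₀ st₁ T₁ → Exec svd d st₁ st₂ T₂ → Exec svd (.seq c d) st₀ st₂ (T₁ + T₂)
  | ite_true (b : Test) (c d : Cmd) (st st' : Store) (T : ℕ) :
      b.Holds st → Exec svd c st st' T → Exec svd (.ite b c d) st st' (b.cost + T)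
  | ite_false (b : Test) (c d : Cmd) (st st' : Store) (T : ℕ) :
      ¬ b.Holds st → Exec svd d st st' T → Exec svd (.ite b c d) st st' (b.cost + T)
  | while_true (b : Test) (c : Cmd) (st₀ st₁ st₂ : Store) (T₁ T₂ : ℕ) :
      b.Holds st₀ → Exec svd c st₀ st₁ T₁ → Exec svd (.while b c) st₁ st₂ T₂ →
        Exec svd (.while b c) st₀ st₂ (b.cost + T₁ + T₂)
  | while_false (b : Test) (c : Cmd) (st : Store) :
      ¬ b.Holds st → Exec svd (.while b c) st st b.cost

/-- The memory at the start: `m`, `n`, `k` in the natural-number registers `0`, `1`, `2`, `ε` in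
the real register `0`, `A` in the array `0` and `b` in column `0` of the array `1`. All else is
`0`. -/
def inputStore {m n : ℕ} (A : Matrix (Fin m) (Fin n) ℝ) (b : Fin m → ℝ) (k : ℕ) (ε : ℝ) : Store :=
  let st : Store := ⟨fun _ => 0, fun _ => 0, fun _ _ _ => 0⟩
  (((((st.setNat 0 m).setNat 1 n).setNat 2 k).setReal 0 ε).setBlock 0 A).setBlock 1
    (Matrix.of fun i (_ : Fin 1) => b i)

/-- The output vector of length `n`: column `0` of the array `2`. -/
def outputVector (st : Store) (n : ℕ) : Fin n → ℝ := fun j => st.arr 2 j 0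

end SparseRegression

open SparseRegression

namespace SparseRegression

/-! ### Potential functions and spectral decompositions -/

/-! The sampling works by a barrier argument in the style of Batson, Spielman and Srivastava. The
invariant is that `B_τ` lies strictly above `l_τ I` and that the potential, which is then the trace
of `(B_τ - l_τ I)⁻¹`, stays at most `√(k/r) < 1`; at the start it equals this value. A potential
below one leaves room to raise the barrier by one, and by the Sherman–Morrison formula the condition
`1/t ≤ L` keeps the rank-one update from ending with a larger potential (`phi_succ_add_le`). Since
the `v_i v_iᵀ` sum to the identity, the values `L` sum to at least `1 - φ ≥ 1 - √(k/r)`, which is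
the sum of the values `U` (`one_sub_phi_le_sum_lowerL`, `sum_upperU`). Hence some column has `U ≤ L`
with `L > 0` (`BarrierInvariant.exists_le`).

For the error, let `T = diag(√t)`. The final barrier gives `W Wᵀ ≻ (r - √(rk)) I` for `W = V_kᵀ Ω
T`, and the bounds `U ≤ 1/t` give `‖E Ω T‖_F² ≤ r ‖E‖_F² / (1 - √(k/r))`. Take `y` of least norm
with `W y = Σ_k⁻¹ U_kᵀ b`. Then `C diag(t) y = A x_k* + E Ω T y`, and `C⁺ b` does at least as well
as `diag(t) y` because `C C⁺` is an orthogonal projection. In the product of the two bounds `r`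
cancels, leaving the factor `1/(1 - √(k/r)) ≤ 1 + ε` (`error_factor_le`, `l2norm_output_sub_le`).

For the running time an explicit program is verified in a Hoare logic with step bounds (`Runs`). Its
frame rule `Exec.same` uses Boolean write sets, so that "this block leaves that register alone" is
closed by `rfl`. A sampling step takes `O(k³ + n k²) = O(n k²)` steps, and there are `O(k/ε²)` of
them. Two identities keep the rest within `O(mn min(m, n))`: the column norms of `E` come from the
tail of the decomposition of `A` (`col_residualMatrix_dotProduct`), and the output depends only on
the total squared weight of each column, so the final problem has `n` columns even when `r` is
larger (`output_eq`). -/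

theorem posDef_conj_diagonal {k : ℕ} {Q : Matrix (Fin k) (Fin k) ℝ} (hQ : Qᵀ * Q = 1)
    {μ : Fin k → ℝ} : (Q * diagonal μ * Qᵀ).PosDef ↔ ∀ j, 0 < μ j := by
  have hQ' : Q * Qᵀ = 1 := mul_eq_one_comm.mp hQ
  constructor
  · intro h j
    have h1 := h.conjTranspose_mul_mul_same (B := Q) (by
      intro x y hxy
      have := congrArg (fun z => Qᵀ *ᵥ z) hxy
      simpa [mulVec_mulVec, hQ] using this)
    have h2 : Qᴴ * (Q * diagonal μ * Qᵀ) * Q = diagonal μ := by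
      rw [conjTranspose_eq_transpose_of_trivial]
      calc Qᵀ * (Q * diagonal μ * Qᵀ) * Q = (Qᵀ * Q) * diagonal μ * (Qᵀ * Q) := by
            simp only [Matrix.mul_assoc]
        _ = _ := by simp [hQ]
    rw [h2, posDef_diagonal_iff] at h1
    exact h1 j
  · intro h
    have h1 := (posDef_diagonal_iff.mpr h).mul_mul_conjTranspose_same (B := Q) (by
      intro x y hxy
      have := congrArg (fun z => z ᵥ* Qᵀ) hxy
      simpa [vecMul_vecMul, hQ'] using this)
    simpa using h1

theorem inv_conj_diagonal {k : ℕ} {Q : Matrix (Fin k) (Fin k) ℝ} (hQ : Qᵀ * Q = 1)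
    {μ : Fin k → ℝ} (hμ : ∀ j, μ j ≠ 0) :
    (Q * diagonal μ * Qᵀ)⁻¹ = Q * diagonal (fun j => (μ j)⁻¹) * Qᵀ := by
  have hQ' : Q * Qᵀ = 1 := mul_eq_one_comm.mp hQ
  apply inv_eq_right_inv
  calc Q * diagonal μ * Qᵀ * (Q * diagonal (fun j => (μ j)⁻¹) * Qᵀ)
      = Q * (diagonal μ * (Qᵀ * Q) * diagonal (fun j => (μ j)⁻¹)) * Qᵀ := by
        simp only [Matrix.mul_assoc]
    _ = 1 := by simp [hQ, hμ, hQ']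

theorem trace_conj_diagonal {k : ℕ} {Q : Matrix (Fin k) (Fin k) ℝ} (hQ : Qᵀ * Q = 1)
    (μ : Fin k → ℝ) : (Q * diagonal μ * Qᵀ).trace = ∑ j, μ j := by
  rw [Matrix.trace_mul_comm, ← Matrix.mul_assoc, hQ, Matrix.one_mul, trace_diagonal]

theorem sq_conj_diagonal {k : ℕ} {Q : Matrix (Fin k) (Fin k) ℝ} (hQ : Qᵀ * Q = 1)
    (μ : Fin k → ℝ) : (Q * diagonal μ * Qᵀ) ^ 2 = Q * diagonal (fun j => μ j ^ 2) * Qᵀ := by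
  calc (Q * diagonal μ * Qᵀ) ^ 2 = Q * (diagonal μ * (Qᵀ * Q) * diagonal μ) * Qᵀ := by
        simp only [Matrix.mul_assoc, sq]
    _ = _ := by simp [hQ, sq]

/-- A spectral decomposition `B = Q diag(λ) Qᵀ`, together with the potentials of `B`. -/
theorem exists_spectral {k : ℕ} {B : Matrix (Fin k) (Fin k) ℝ} (hB : B.IsHermitian) :
    ∃ (Q : Matrix (Fin k) (Fin k) ℝ) (μ : Fin k → ℝ), Qᵀ * Q = 1 ∧
      (∀ l : ℝ, B - l • (1 : Matrix (Fin k) (Fin k) ℝ) = Q * diagonal (fun j => μ j - l) * Qᵀ) ∧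
      ∀ l, phi l B = ∑ j, 1 / (μ j - l) := by
  have hQ : (hB.eigenvectorUnitary : Matrix (Fin k) (Fin k) ℝ)ᵀ *
      (hB.eigenvectorUnitary : Matrix (Fin k) (Fin k) ℝ) = 1 := by
    have := Unitary.coe_star_mul_self hB.eigenvectorUnitary
    rwa [star_eq_conjTranspose, conjTranspose_eq_transpose_of_trivial] at this
  refine ⟨hB.eigenvectorUnitary, hB.eigenvalues, hQ, fun l => ?_, fun l => ?_⟩
  · have h := hB.spectral_theorem
    rw [Unitary.conjStarAlgAut_apply] at h
    have h1 : diagonal (fun j => hB.eigenvalues j - l) =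
        diagonal hB.eigenvalues - l • (1 : Matrix (Fin k) (Fin k) ℝ) := by
      rw [smul_one_eq_diagonal, diagonal_sub]
    rw [h1, Matrix.mul_sub, Matrix.sub_mul, Matrix.mul_smul, Matrix.mul_one, Matrix.smul_mul,
      mul_eq_one_comm.mp hQ]
    congr 1
  · rw [phi, hB.roots_charpoly_eq_eigenvalues, Multiset.map_map]
    rfl

theorem isHermitian_of_sub_smul_one {k : ℕ} {B : Matrix (Fin k) (Fin k) ℝ} {l : ℝ}
    (h : (B - l • (1 : Matrix (Fin k) (Fin k) ℝ)).IsHermitian) : B.IsHermitian := by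
  have h1 : (l • (1 : Matrix (Fin k) (Fin k) ℝ)).IsHermitian := by
    rw [smul_one_eq_diagonal]; exact isHermitian_diagonal _
  simpa using h.add h1

/-- The trace form is the one to which the Sherman–Morrison formula applies, and the one the program
evaluates. -/
theorem phi_eq_trace_inv {k : ℕ} {B : Matrix (Fin k) (Fin k) ℝ} {l : ℝ}
    (h : (B - l • (1 : Matrix (Fin k) (Fin k) ℝ)).PosDef) :
    phi l B = (B - l • (1 : Matrix (Fin k) (Fin k) ℝ))⁻¹.trace := by
  obtain ⟨Q, μ, hQ, hBl, hphi⟩ := exists_spectral (isHermitian_of_sub_smul_one h.1)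
  rw [hBl, posDef_conj_diagonal hQ] at h
  rw [hphi, hBl, inv_conj_diagonal hQ fun j => (h j).ne', trace_conj_diagonal hQ]
  simp

/-- If the potential is less than one, then the barrier can be raised by one. -/
theorem posDef_sub_succ {k : ℕ} {B : Matrix (Fin k) (Fin k) ℝ} {l : ℝ}
    (h : (B - l • (1 : Matrix (Fin k) (Fin k) ℝ)).PosDef) (hphi : phi l B < 1) :
    (B - (l + 1) • (1 : Matrix (Fin k) (Fin k) ℝ)).PosDef := by
  obtain ⟨Q, μ, hQ, hBl, hp⟩ := exists_spectral (isHermitian_of_sub_smul_one h.1)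
  rw [hBl, posDef_conj_diagonal hQ] at h ⊢
  intro j
  have h1 : 1 / (μ j - l) ≤ phi l B := by
    rw [hp]
    exact Finset.single_le_sum (f := fun j => 1 / (μ j - l))
      (fun i _ => (one_div_pos.mpr (h i)).le) (Finset.mem_univ j)
  have h2 := h1.trans_lt hphi
  rw [div_lt_one (h j)] at h2
  linarith

/-- Each reciprocal grows as the barrier approaches the spectrum. Strictness makes the denominator
in `lowerL` positive. -/
theorem phi_lt_phi_succ {k : ℕ} (hk : 0 < k) {B : Matrix (Fin k) (Fin k) ℝ} {l : ℝ}
    (h : (B - l • (1 : Matrix (Fin k) (Fin k) ℝ)).PosDef) (hphi : phi l B < 1) :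
    phi l B < phi (l + 1) B := by
  have h' := posDef_sub_succ h hphi
  obtain ⟨Q, μ, hQ, hBl, hp⟩ := exists_spectral (isHermitian_of_sub_smul_one h.1)
  rw [hBl, posDef_conj_diagonal hQ] at h h'
  rw [hp, hp]
  refine Finset.sum_lt_sum_of_nonempty ⟨⟨0, hk⟩, Finset.mem_univ _⟩ fun j _ => ?_
  exact one_div_lt_one_div_of_lt (h' j) (by linarith)

/-- Cyclicity of the trace. This is how orthonormality of the rows of `Vt` enters the averaging
argument. -/
theorem sum_quadratic {k n : ℕ} {Vt : Matrix (Fin k) (Fin n) ℝ} (hV : Vt * Vtᵀ = 1)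
    (X : Matrix (Fin k) (Fin k) ℝ) : ∑ i, Vt.col i ⬝ᵥ (X *ᵥ Vt.col i) = X.trace := by
  have h : (Vtᵀ * (X * Vt)).trace = X.trace := by
    rw [Matrix.trace_mul_comm, Matrix.mul_assoc, hV, Matrix.mul_one]
  rw [← h]
  refine Finset.sum_congr rfl fun i _ => ?_
  simp only [diag_apply, mul_apply, dotProduct, mulVec, transpose_apply, col_apply]

/-- The lower bounds on the inverse weights are large on average. -/
theorem one_sub_phi_le_sum_lowerL {k n : ℕ} (hk : 0 < k) {Vt : Matrix (Fin k) (Fin n) ℝ}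
    (hV : Vt * Vtᵀ = 1) {B : Matrix (Fin k) (Fin k) ℝ} {l : ℝ}
    (h : (B - l • (1 : Matrix (Fin k) (Fin k) ℝ)).PosDef) (hphi : phi l B < 1) :
    1 - phi l B ≤ ∑ i, lowerL (Vt.col i) B l := by
  have h' := posDef_sub_succ h hphi
  have hlt := phi_lt_phi_succ hk h hphi
  simp only [lowerL, Finset.sum_sub_distrib, ← Finset.sum_div]
  rw [sum_quadratic hV, sum_quadratic hV]
  obtain ⟨Q, μ, hQ, hBl, hp⟩ := exists_spectral (isHermitian_of_sub_smul_one h.1)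
  rw [hBl, posDef_conj_diagonal hQ] at h h'
  rw [hBl, inv_conj_diagonal hQ fun j => (h' j).ne', sq_conj_diagonal hQ,
    trace_conj_diagonal hQ, trace_conj_diagonal hQ]
  set x : Fin k → ℝ := fun j => (μ j - (l + 1))⁻¹ with hx
  set y : Fin k → ℝ := fun j => (μ j - l)⁻¹ with hy
  have hx0 : ∀ j, 0 < x j := fun j => inv_pos.mpr (h' j)
  have hy0 : ∀ j, 0 < y j := fun j => inv_pos.mpr (h j)
  -- The two denominators differ by one, so the potential gap is `∑ x y`.
  have hxy : ∀ j, x j - y j = x j * y j := fun j => by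
    have := (h j).ne'
    have := (h' j).ne'
    simp only [hx, hy]
    field_simp
    ring
  have hpl : phi l B = ∑ j, y j := by simp [hp, hy]
  have hpl' : phi (l + 1) B = ∑ j, x j := by simp [hp, hx]
  have hd : phi (l + 1) B - phi l B = ∑ j, x j * y j := by
    rw [hpl, hpl', ← Finset.sum_sub_distrib]
    exact Finset.sum_congr rfl fun j _ => hxy j
  have hdpos : 0 < ∑ j, x j * y j := by rw [← hd]; linarith
  rw [hd]
  -- Cauchy–Schwarz with weights `y`. As `∑ y = φ < 1`, the last factor can be dropped; together
  -- with `x² = x y + x² y` this gives `∑ x² / ∑ x y ≥ 1 + ∑ x y = 1 + ∑ x - φ`.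
  have hcs : (∑ j, x j * y j) ^ 2 ≤ (∑ j, x j ^ 2 * y j) * ∑ j, y j :=
    Finset.sum_sq_le_sum_mul_sum_of_sq_le_mul _ (fun j _ => by have := hy0 j; positivity)
      (fun j _ => (hy0 j).le) (fun j _ => le_of_eq (by ring))
  have hp0 : 0 ≤ ∑ j, x j ^ 2 * y j :=
    Finset.sum_nonneg fun j _ => by have := hy0 j; positivity
  have hcs' : (∑ j, x j * y j) ^ 2 ≤ ∑ j, x j ^ 2 * y j := by
    rw [hpl] at hphi
    nlinarith
  have hsq : ∑ j, x j ^ 2 = ∑ j, x j * y j + ∑ j, x j ^ 2 * y j := by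
    rw [← Finset.sum_add_distrib]
    refine Finset.sum_congr rfl fun j _ => ?_
    have := hxy j
    calc x j ^ 2 = x j * y j + x j * (x j - y j) := by ring
      _ = _ := by rw [this]; ring
  have hfin : 1 + ∑ j, x j * y j ≤ (∑ j, x j ^ 2) / ∑ j, x j * y j := by
    rw [le_div_iff₀ hdpos, hsq]
    nlinarith
  have : phi (l + 1) B - phi l B = (∑ j, x j) - phi l B := by rw [hpl']
  linarith

/-- The inverse of a rank-one update. -/
theorem inv_add_smul_vecMulVec {k : ℕ} {M : Matrix (Fin k) (Fin k) ℝ} (hM : M.PosDef)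
    (v : Fin k → ℝ) {t : ℝ} (ht : 0 < t) :
    (M + t • vecMulVec v v)⁻¹ =
      M⁻¹ - (t / (1 + t * (v ⬝ᵥ (M⁻¹ *ᵥ v)))) • vecMulVec (M⁻¹ *ᵥ v) (M⁻¹ *ᵥ v) := by
  have hu : IsUnit M.det := (isUnit_iff_isUnit_det M).mp hM.isUnit
  have hq : 0 ≤ v ⬝ᵥ (M⁻¹ *ᵥ v) := by
    simpa using hM.inv.posSemidef.dotProduct_mulVec_nonneg v
  have hq' : 0 < 1 + t * (v ⬝ᵥ (M⁻¹ *ᵥ v)) := by positivity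
  have hsym : M⁻¹ᵀ = M⁻¹ := by
    simpa [IsHermitian] using hM.inv.1
  have hvM : v ᵥ* M⁻¹ = M⁻¹ *ᵥ v := by
    rw [← mulVec_transpose, hsym]
  -- The Sherman–Morrison formula, checked by multiplying out. Positivity of `M⁻¹` keeps the
  -- denominator `1 + t q` away from zero.
  apply inv_eq_right_inv
  rw [Matrix.add_mul, Matrix.mul_sub, Matrix.mul_sub, mul_nonsing_inv _ hu, Matrix.mul_smul,
    mul_vecMulVec, mulVec_mulVec, mul_nonsing_inv _ hu, one_mulVec, Matrix.smul_mul,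
    vecMulVec_mul, hvM, Matrix.smul_mul, Matrix.mul_smul, vecMulVec_mul_vecMulVec]
  set q := v ⬝ᵥ (M⁻¹ *ᵥ v)
  have : t - (t / (1 + t * q) + t * (t / (1 + t * q)) * q) = 0 := by
    field_simp
    ring
  simp only [vecMulVec_smul, smul_smul]
  have e : ∀ W : Matrix (Fin k) (Fin k) ℝ, ∀ a b c : ℝ, a - (b + c) = 0 →
      1 - b • W + (a • W - c • W) = 1 := by
    intro W a b c habc
    have : a = b + c := by linarith
    rw [this, add_smul]; abel
  apply e
  rw [← mul_assoc]
  exact this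

/-- A weight below the lower bound does not increase the potential. -/
theorem phi_succ_add_le {k : ℕ} (hk : 0 < k) {B : Matrix (Fin k) (Fin k) ℝ} {l : ℝ}
    (h : (B - l • (1 : Matrix (Fin k) (Fin k) ℝ)).PosDef) (hphi : phi l B < 1)
    {v : Fin k → ℝ} {t : ℝ} (ht : 0 < t) (hL : 1 / t ≤ lowerL v B l) :
    (B + t • vecMulVec v v - (l + 1) • (1 : Matrix (Fin k) (Fin k) ℝ)).PosDef ∧
      phi (l + 1) (B + t • vecMulVec v v) ≤ phi l B := by
  have h' := posDef_sub_succ h hphi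
  have hlt := phi_lt_phi_succ hk h hphi
  have hM : B + t • vecMulVec v v - (l + 1) • (1 : Matrix (Fin k) (Fin k) ℝ) =
      (B - (l + 1) • (1 : Matrix (Fin k) (Fin k) ℝ)) + t • vecMulVec v v := by abel
  have hpd : (B + t • vecMulVec v v - (l + 1) • (1 : Matrix (Fin k) (Fin k) ℝ)).PosDef := by
    rw [hM]
    refine h'.add_posSemidef (PosSemidef.smul ?_ ht.le)
    simpa using posSemidef_vecMulVec_self_star v
  refine ⟨hpd, ?_⟩
  rw [phi_eq_trace_inv hpd, hM, inv_add_smul_vecMulVec h' v ht, trace_sub,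
    ← phi_eq_trace_inv h', trace_smul, trace_vecMulVec]
  unfold lowerL at hL
  set M := B - (l + 1) • (1 : Matrix (Fin k) (Fin k) ℝ)
  have hsym : M⁻¹ᵀ = M⁻¹ := by
    simpa [IsHermitian] using h'.inv.1
  have hvv : v ⬝ᵥ ((M⁻¹ ^ 2) *ᵥ v) = (M⁻¹ *ᵥ v) ⬝ᵥ (M⁻¹ *ᵥ v) := by
    rw [sq, ← mulVec_mulVec, dotProduct_mulVec, ← mulVec_transpose, hsym]
  have hq : 0 ≤ v ⬝ᵥ (M⁻¹ *ᵥ v) := by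
    simpa using h'.inv.posSemidef.dotProduct_mulVec_nonneg v
  rw [hvv] at hL
  set q := v ⬝ᵥ (M⁻¹ *ᵥ v)
  set p := (M⁻¹ *ᵥ v) ⬝ᵥ (M⁻¹ *ᵥ v)
  have hq' : 0 < 1 + t * q := by positivity
  -- Clearing denominators turns this into `φ(l + 1) - φ(l) ≤ t p / (1 + t q)`. The right side is
  -- the drop in the trace caused by the update, so it pays for raising the barrier.
  have h1 : 1 / t + q ≤ p / (phi (l + 1) B - phi l B) := by linarith
  rw [le_div_iff₀ (by linarith)] at h1
  have h2 : (1 / t + q) * t = 1 + t * q := by field_simp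
  have h3 : phi (l + 1) B - phi l B ≤ t / (1 + t * q) * p := by
    rw [div_mul_eq_mul_div, le_div_iff₀ hq', ← h2]
    nlinarith
  simp only [smul_eq_mul]
  linarith

/-! ### The sampling procedure does not get stuck -/

/-- What the sampling procedure maintains: `B` is above the barrier and has small potential. -/
def BarrierInvariant {k : ℕ} (r τ : ℕ) (B : Matrix (Fin k) (Fin k) ℝ) : Prop :=
  (B - barrier k r τ • (1 : Matrix (Fin k) (Fin k) ℝ)).PosDef ∧
    phi (barrier k r τ) B ≤ √((k : ℝ) / r)

theorem barrier_succ (k r τ : ℕ) : barrier k r (τ + 1) = barrier k r τ + 1 := by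
  simp only [barrier]; push_cast; ring

theorem sqrt_div_lt_one {k r : ℕ} (hkr : k < r) : √((k : ℝ) / r) < 1 := by
  rw [Real.sqrt_lt' one_pos, one_pow, div_lt_one]
  · exact_mod_cast hkr
  · exact_mod_cast (Nat.zero_le k).trans_lt hkr

/-- The choice `l_0 = -√(rk)` makes the initial potential `k / √(rk) = √(k/r)`, so the invariant
starts with equality. -/
theorem barrierInvariant_zero {k r : ℕ} (hk : 0 < k) (hkr : k < r) :
    BarrierInvariant r 0 (0 : Matrix (Fin k) (Fin k) ℝ) := by
  have hr : (0 : ℝ) < r := by exact_mod_cast hk.trans hkr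
  have hk' : (0 : ℝ) < k := by exact_mod_cast hk
  have h0 : (0 : Matrix (Fin k) (Fin k) ℝ) - barrier k r 0 • 1 =
      diagonal fun _ => √((r : ℝ) * k) := by
    rw [smul_one_eq_diagonal, zero_sub, diagonal_neg]
    simp [barrier]
  have hpd : ((0 : Matrix (Fin k) (Fin k) ℝ) - barrier k r 0 • 1).PosDef := by
    rw [h0, posDef_diagonal_iff]
    intro _; positivity
  refine ⟨hpd, ?_⟩
  rw [phi_eq_trace_inv hpd, h0]
  have hinv : (diagonal fun _ : Fin k => √((r : ℝ) * k))⁻¹ =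
      diagonal fun _ => (√((r : ℝ) * k))⁻¹ := by
    apply inv_eq_right_inv
    rw [diagonal_mul_diagonal]
    simp only [mul_inv_cancel₀ (show √((r : ℝ) * k) ≠ 0 by positivity), diagonal_one]
  rw [hinv, trace_diagonal, Finset.sum_const, Finset.card_univ, Fintype.card_fin, nsmul_eq_mul,
    Real.sqrt_mul hr.le, Real.sqrt_div hk'.le]
  apply le_of_eq
  have := Real.mul_self_sqrt hk'.le
  have h1 : √(k : ℝ) ≠ 0 := by positivity
  have h2 : √(r : ℝ) ≠ 0 := by positivity
  field_simp
  linarith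

/-- Only `0 < t` and `1/t ≤ L` matter here; the bounds `U ≤ 1/t` are kept for the error estimate. -/
theorem SamplingSteps.barrierInvariant {k m n r : ℕ} (hk : 0 < k) (hkr : k < r)
    {Vt : Matrix (Fin k) (Fin n) ℝ} {E : Matrix (Fin m) (Fin n) ℝ} {i : ℕ → Fin n} {t : ℕ → ℝ} :
    ∀ {N : ℕ}, SamplingSteps Vt E r N i t → BarrierInvariant r N (accum Vt i t N)
  | 0, _ => barrierInvariant_zero hk hkr
  | N + 1, h => by
    have ih := SamplingSteps.barrierInvariant hk hkr (N := N)
      fun τ hτ => h τ (hτ.trans (Nat.lt_succ_self N))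
    obtain ⟨ht, -, hL⟩ := h N (Nat.lt_succ_self N)
    have := phi_succ_add_le hk ih.1 (ih.2.trans_lt (sqrt_div_lt_one hkr)) ht hL
    rw [BarrierInvariant, barrier_succ]
    exact ⟨this.1, this.2.trans ih.2⟩

theorem frobNorm_sq {m n : ℕ} (E : Matrix (Fin m) (Fin n) ℝ) :
    frobNorm E ^ 2 = ∑ i, E.col i ⬝ᵥ E.col i := by
  have h : 0 ≤ ∑ i, ∑ j, E i j ^ 2 :=
    Finset.sum_nonneg fun i _ => Finset.sum_nonneg fun j _ => sq_nonneg _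
  rw [frobNorm, Real.sq_sqrt h, Finset.sum_comm]
  simp [dotProduct, sq]

/-- The normalisation in `upperU` is chosen so that this total matches the lower estimate for the
sum of the values of `lowerL`. -/
theorem sum_upperU {m n : ℕ} {E : Matrix (Fin m) (Fin n) ℝ} (hE : frobNorm E ≠ 0) (k r : ℕ) :
    ∑ i, upperU E k r (E.col i) = 1 - √((k : ℝ) / r) := by
  simp only [upperU]
  rw [← Finset.sum_mul, ← Finset.sum_div, ← frobNorm_sq, div_self (pow_ne_zero 2 hE), one_mul]

theorem upperU_nonneg {m n k r : ℕ} (hkr : k < r) (E : Matrix (Fin m) (Fin n) ℝ) (e : Fin m → ℝ) :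
    0 ≤ upperU E k r e := by
  have h1 : 0 ≤ 1 - √((k : ℝ) / r) := by linarith [sqrt_div_lt_one hkr]
  have h2 : 0 ≤ e ⬝ᵥ e := by simpa using dotProduct_star_self_nonneg e
  unfold upperU
  positivity

/-- Some column has a positive lower bound that is at least its upper bound. -/
theorem BarrierInvariant.exists_le {k m n r τ : ℕ} (hk : 0 < k) (hkr : k < r)
    {Vt : Matrix (Fin k) (Fin n) ℝ} (hV : Vt * Vtᵀ = 1) {E : Matrix (Fin m) (Fin n) ℝ}
    (hE : frobNorm E ≠ 0) {B : Matrix (Fin k) (Fin k) ℝ} (hB : BarrierInvariant r τ B) :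
    ∃ i, upperU E k r (E.col i) ≤ lowerL (Vt.col i) B (barrier k r τ) ∧
      0 < lowerL (Vt.col i) B (barrier k r τ) := by
  have hlt := sqrt_div_lt_one hkr
  have h1 := one_sub_phi_le_sum_lowerL hk hV hB.1 (hB.2.trans_lt hlt)
  have h2 := sum_upperU hE k r
  by_contra! hc
  -- Comparing sums alone could yield a column with `U = L = 0`, which admits no weight. If no
  -- column has `U ≤ L` and `L > 0`, then `L ≤ U` everywhere, so the sums force equality; then every
  -- value is at most zero, although the `U` sum to `1 - √(k/r) > 0`.
  have hle : ∀ i, lowerL (Vt.col i) B (barrier k r τ) ≤ upperU E k r (E.col i) := fun i => by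
    by_contra! h
    exact absurd (hc i h.le) (not_le.mpr ((upperU_nonneg hkr E _).trans_lt h))
  have heq : ∑ i, lowerL (Vt.col i) B (barrier k r τ) = ∑ i, upperU E k r (E.col i) :=
    le_antisymm (Finset.sum_le_sum fun i _ => hle i) (by linarith [hB.2])
  have heq' := (Finset.sum_eq_sum_iff_of_le fun i _ => hle i).mp heq
  have : ∑ i, upperU E k r (E.col i) ≤ 0 := Finset.sum_nonpos fun i hi => by
    rw [← heq' i hi]
    exact hc i (heq' i hi).ge
  linarith

theorem BarrierInvariant.exists_admissible {k m n r τ : ℕ} (hk : 0 < k) (hkr : k < r)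
    {Vt : Matrix (Fin k) (Fin n) ℝ} (hV : Vt * Vtᵀ = 1) {E : Matrix (Fin m) (Fin n) ℝ}
    (hE : frobNorm E ≠ 0) {B : Matrix (Fin k) (Fin k) ℝ} (hB : BarrierInvariant r τ B) :
    ∃ i t, Admissible Vt E r B τ i t := by
  obtain ⟨i, h1, h2⟩ := hB.exists_le hk hkr hV hE
  -- The least admissible weight, with `1/t = L`; the program makes the same choice.
  exact ⟨i, 1 / lowerL (Vt.col i) B (barrier k r τ), by positivity, by simpa using h1, by simp⟩

/-! ### The pseudo-inverse -/

/-- The four Penrose equations. -/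
structure IsPenroseInverse {m n : ℕ} (A : Matrix (Fin m) (Fin n) ℝ)
    (X : Matrix (Fin n) (Fin m) ℝ) : Prop where
  mul_mul : A * X * A = A
  mul_mul' : X * A * X = X
  symm_left : (A * X)ᵀ = A * X
  symm_right : (X * A)ᵀ = X * A

/-- `A X = A Y` since `A X` and `A Y` are both the orthogonal projection onto the column space, and
likewise `X A = Y A`. Pseudo-inverses can thus be identified without exhibiting a compact
decomposition. -/
theorem IsPenroseInverse.unique {m n : ℕ} {A : Matrix (Fin m) (Fin n) ℝ}
    {X Y : Matrix (Fin n) (Fin m) ℝ} (hX : IsPenroseInverse A X) (hY : IsPenroseInverse A Y) :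
    X = Y := by
  have h1 : A * X = A * Y := by
    calc A * X = (A * Y * A * X)ᵀ := by rw [hY.mul_mul, hX.symm_left]
      _ = A * X * (A * Y) := by
        rw [Matrix.mul_assoc (A * Y), transpose_mul, hX.symm_left, hY.symm_left]
      _ = A * Y := by rw [← Matrix.mul_assoc, hX.mul_mul]
  have h2 : X * A = Y * A := by
    calc X * A = (X * A * (Y * A))ᵀ := by
          rw [Matrix.mul_assoc, ← Matrix.mul_assoc A, hY.mul_mul, hX.symm_right]
      _ = Y * A * (X * A) := by rw [transpose_mul, hX.symm_right, hY.symm_right]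
      _ = Y * A := by rw [Matrix.mul_assoc, ← Matrix.mul_assoc A, hX.mul_mul]
  calc X = X * A * X := hX.mul_mul'.symm
    _ = Y * A * Y := by rw [Matrix.mul_assoc, h1, ← Matrix.mul_assoc, h2]
    _ = Y := hY.mul_mul'

theorem CompactSVD.isPenroseInverse {m n : ℕ} {A : Matrix (Fin m) (Fin n) ℝ} (D : CompactSVD A) :
    IsPenroseInverse A D.pinv :=
  ⟨D.mul_pinv_mul, D.pinv_mul_pinv, by rw [D.mul_pinv, transpose_mul, transpose_transpose],
    by rw [D.pinv_mul, transpose_mul, transpose_transpose]⟩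

theorem isPenroseInverse_pinv {m n : ℕ} (A : Matrix (Fin m) (Fin n) ℝ) :
    IsPenroseInverse A (pinv A) := (Classical.choice (exists_compactSVD A)).isPenroseInverse

/-- This lets the machine evaluate expressions in an inverse matrix from its decomposition
primitive. -/
theorem CompactSVD.pinv_eq_inv {k : ℕ} {M : Matrix (Fin k) (Fin k) ℝ} (D : CompactSVD M)
    (hM : IsUnit M.det) : D.pinv = M⁻¹ := by
  refine (D.isPenroseInverse).unique ⟨?_, ?_, ?_, ?_⟩ <;>
    simp [mul_nonsing_inv _ hM, nonsing_inv_mul _ hM]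

/-- `C⁺ᵀ C⁺` depends only on `C Cᵀ`. -/
theorem isPenroseInverse_mul_transpose {m n : ℕ} (C : Matrix (Fin m) (Fin n) ℝ) :
    IsPenroseInverse (C * Cᵀ) ((pinv C)ᵀ * pinv C) := by
  have h := isPenroseInverse_pinv C
  have h1 : C * Cᵀ * ((pinv C)ᵀ * pinv C) = C * pinv C := by
    calc _ = C * (pinv C * C)ᵀ * pinv C := by rw [transpose_mul]; simp only [Matrix.mul_assoc]
      _ = _ := by rw [h.symm_right, ← Matrix.mul_assoc, h.mul_mul]
  have h2 : (pinv C)ᵀ * pinv C * (C * Cᵀ) = C * pinv C := by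
    calc _ = (C * Cᵀ * ((pinv C)ᵀ * pinv C))ᵀ := by
          simp only [transpose_mul, transpose_transpose]
      _ = _ := by rw [h1, h.symm_left]
  refine ⟨?_, ?_, by rw [h1, h.symm_left], by rw [h2, h.symm_left]⟩
  · rw [h1, ← Matrix.mul_assoc, h.mul_mul]
  · rw [h2, ← Matrix.mul_assoc, ← h.symm_left, ← transpose_mul, ← Matrix.mul_assoc, h.mul_mul']

/-- In view of `isPenroseInverse_mul_transpose` this is `C⁺ = Cᵀ (C Cᵀ)⁺`. -/
theorem pinv_eq_transpose_mul {m n : ℕ} (C : Matrix (Fin m) (Fin n) ℝ) :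
    pinv C = Cᵀ * ((pinv C)ᵀ * pinv C) := by
  have h := isPenroseInverse_pinv C
  rw [← Matrix.mul_assoc, ← transpose_mul, h.symm_right, h.mul_mul']

/-- Reweighting columns: `G (A G)⁺` depends only on `G Gᵀ`. -/
theorem mul_pinv_mul_congr {m n p q : ℕ} (A : Matrix (Fin m) (Fin n) ℝ)
    {G : Matrix (Fin n) (Fin p) ℝ} {H : Matrix (Fin n) (Fin q) ℝ} (h : G * Gᵀ = H * Hᵀ) :
    G * pinv (A * G) = H * pinv (A * H) := by
  have hc : A * G * (A * G)ᵀ = A * H * (A * H)ᵀ := by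
    rw [transpose_mul, transpose_mul, Matrix.mul_assoc, ← Matrix.mul_assoc G, h]
    simp only [Matrix.mul_assoc]
  have hK : (pinv (A * G))ᵀ * pinv (A * G) = (pinv (A * H))ᵀ * pinv (A * H) := by
    have h1 := isPenroseInverse_mul_transpose (A * G)
    rw [hc] at h1
    exact h1.unique (isPenroseInverse_mul_transpose (A * H))
  -- Now `G (A G)⁺ = G Gᵀ Aᵀ (A G Gᵀ Aᵀ)⁺`, where `G` occurs only through `G Gᵀ`.
  rw [pinv_eq_transpose_mul (A * G), pinv_eq_transpose_mul (A * H), hK, transpose_mul,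
    transpose_mul, ← Matrix.mul_assoc, ← Matrix.mul_assoc, ← Matrix.mul_assoc G, h]
  simp only [Matrix.mul_assoc]

/-! ### The truncated decomposition -/

namespace CompactSVD

variable {m n : ℕ} {A : Matrix (Fin m) (Fin n) ℝ} (D : CompactSVD A) {k : ℕ} (hk : k ≤ A.rank)

theorem Uk_orth : (D.Uk hk)ᵀ * D.Uk hk = 1 := by
  have h := congrArg (fun M => M.submatrix (Fin.castLE hk) (Fin.castLE hk)) D.U_orth
  simp only [submatrix_one _ (Fin.castLE_injective hk)] at h
  exact h

theorem Vk_orth : (D.Vk hk)ᵀ * D.Vk hk = 1 := by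
  have h := congrArg (fun M => M.submatrix (Fin.castLE hk) (Fin.castLE hk)) D.V_orth
  simp only [submatrix_one _ (Fin.castLE_injective hk)] at h
  exact h

theorem mul_Vk : A * D.Vk hk = D.Uk hk * diagonal (D.sk hk) := by
  have h : A * D.V = D.U * diagonal D.s := by
    have := congrArg (· * D.V) D.eq
    simpa only [Matrix.mul_assoc, D.V_orth, Matrix.mul_one] using this
  have h' := congrArg (fun M => M.submatrix id (Fin.castLE hk)) h
  ext i j
  have := congrFun (congrFun h' i) j
  simp only [submatrix_apply, id, mul_diagonal] at this
  rw [mul_diagonal]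
  exact this

theorem residualMatrix_eq : residualMatrix D hk = A - D.Ak hk := by
  rw [residualMatrix, Ak, D.mul_Vk]

/-- If `E` vanished, `A = A V_k V_kᵀ` would have rank at most `k`. This makes the division by
`‖E‖_F²` in `upperU` meaningful. -/
theorem frobNorm_residualMatrix_ne_zero (hk' : k < A.rank) :
    frobNorm (residualMatrix D hk) ≠ 0 := by
  intro h
  have h0 : residualMatrix D hk = 0 := by
    have h1 : 0 ≤ ∑ i, ∑ j, residualMatrix D hk i j ^ 2 :=
      Finset.sum_nonneg fun i _ => Finset.sum_nonneg fun j _ => sq_nonneg _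
    rw [frobNorm, Real.sqrt_eq_zero h1] at h
    ext i j
    have h2 := (Finset.sum_eq_zero_iff_of_nonneg fun i _ =>
      Finset.sum_nonneg fun j _ => sq_nonneg _).mp h i (Finset.mem_univ _)
    have h3 := (Finset.sum_eq_zero_iff_of_nonneg fun j _ => sq_nonneg _).mp h2 j
      (Finset.mem_univ _)
    exact pow_eq_zero_iff two_ne_zero |>.mp h3
  rw [residualMatrix, Matrix.mul_assoc, sub_eq_zero] at h0
  have h1 := (rank_mul_le_right A (D.Vk hk * (D.Vk hk)ᵀ)).trans (rank_mul_le_left _ _)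
  rw [← h0] at h1
  have h2 := (D.Vk hk).rank_le_width
  omega

/-- The squared column norms of the residual can be read off from the decomposition. -/
theorem col_residualMatrix_dotProduct (i : Fin n) :
    (residualMatrix D hk).col i ⬝ᵥ (residualMatrix D hk).col i =
      ∑ j : Fin A.rank, if (j : ℕ) < k then 0 else (D.s j * D.V i j) ^ 2 := by
  -- `W` is `Σ Vᵀ` with its first `k` rows zeroed. Since `E = U W` and `U` has orthonormal columns,
  -- `Eᵀ E = Wᵀ W`.
  set W : Matrix (Fin A.rank) (Fin n) ℝ :=
    diagonal (fun j : Fin A.rank => if (j : ℕ) < k then 0 else D.s j) * D.Vᵀ with hW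
  have hE : residualMatrix D hk = D.U * W := by
    have h1 : D.Ak hk = D.U *
        (diagonal (fun j : Fin A.rank => if (j : ℕ) < k then D.s j else 0) * D.Vᵀ) := by
      ext a b
      rw [Ak, mul_apply, mul_apply]
      simp only [mul_diagonal, diagonal_mul, transpose_apply, Uk, Vk, sk, submatrix_apply, id]
      symm
      calc ∑ j, D.U a j * ((if (j : ℕ) < k then D.s j else 0) * D.V b j)
          = ∑ j ∈ Finset.univ.map ⟨Fin.castLE hk, Fin.castLE_injective hk⟩,
              D.U a j * ((if (j : ℕ) < k then D.s j else 0) * D.V b j) := by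
            symm
            refine Finset.sum_subset (Finset.subset_univ _) fun j _ hj => ?_
            rw [if_neg, zero_mul, mul_zero]
            intro hlt
            exact hj (Finset.mem_map.mpr ⟨⟨j, hlt⟩, Finset.mem_univ _, Fin.ext rfl⟩)
        _ = _ := by
            rw [Finset.sum_map]
            refine Finset.sum_congr rfl fun j _ => ?_
            simp [mul_assoc]
    have h2 : A = D.U * (diagonal D.s * D.Vᵀ) := by rw [← Matrix.mul_assoc]; exact D.eq
    rw [residualMatrix_eq, h1, hW]
    refine (congrArg (· - _) h2).trans ?_
    rw [← Matrix.mul_sub, ← Matrix.sub_mul, diagonal_sub]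
    congr 3
    ext a
    split_ifs <;> simp
  have h3 : (residualMatrix D hk).col i ⬝ᵥ (residualMatrix D hk).col i = (Wᵀ * W) i i := by
    have : Wᵀ * W = (residualMatrix D hk)ᵀ * residualMatrix D hk := by
      rw [hE, transpose_mul D.U W, Matrix.mul_assoc, ← Matrix.mul_assoc D.Uᵀ, D.U_orth,
        Matrix.one_mul]
    rw [this]; rfl
  rw [h3, mul_apply]
  refine Finset.sum_congr rfl fun j _ => ?_
  rw [hW, transpose_apply, diagonal_mul, transpose_apply]
  split_ifs <;> ring

/-- Checking the Penrose equations avoids building a `CompactSVD` of `A_k`, whose type involves the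
rank of `A_k`. -/
theorem isPenroseInverse_Ak :
    IsPenroseInverse (D.Ak hk) (D.Vk hk * diagonal (fun j => (D.sk hk j)⁻¹) * (D.Uk hk)ᵀ) := by
  have hs : ∀ j, D.sk hk j ≠ 0 := fun j => (D.s_pos _).ne'
  have h1 : D.Ak hk * (D.Vk hk * diagonal (fun j => (D.sk hk j)⁻¹) * (D.Uk hk)ᵀ) =
      D.Uk hk * (D.Uk hk)ᵀ := by
    calc _ = D.Uk hk * (diagonal (D.sk hk) * ((D.Vk hk)ᵀ * D.Vk hk) *
          diagonal (fun j => (D.sk hk j)⁻¹)) * (D.Uk hk)ᵀ := by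
          simp only [Ak, Matrix.mul_assoc]
      _ = _ := by simp [Vk_orth, hs]
  have h2 : (D.Vk hk * diagonal (fun j => (D.sk hk j)⁻¹) * (D.Uk hk)ᵀ) * D.Ak hk =
      D.Vk hk * (D.Vk hk)ᵀ := by
    calc _ = D.Vk hk * (diagonal (fun j => (D.sk hk j)⁻¹) * ((D.Uk hk)ᵀ * D.Uk hk) *
          diagonal (D.sk hk)) * (D.Vk hk)ᵀ := by
          simp only [Ak, Matrix.mul_assoc]
      _ = _ := by simp [Uk_orth, hs]
  refine ⟨?_, ?_, ?_, ?_⟩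
  · rw [h1, Ak, Matrix.mul_assoc (D.Uk hk), Matrix.mul_assoc (D.Uk hk) (diagonal _),
      ← Matrix.mul_assoc (D.Uk hk)ᵀ, Uk_orth, Matrix.one_mul]
  · rw [h2, Matrix.mul_assoc (D.Vk hk), Matrix.mul_assoc (D.Vk hk) (diagonal _),
      ← Matrix.mul_assoc (D.Vk hk)ᵀ, Vk_orth, Matrix.one_mul]
  · rw [h1, transpose_mul, transpose_transpose]
  · rw [h2, transpose_mul, transpose_transpose]

/-- `A x_k^* = U_k U_kᵀ b`. -/
theorem mul_pinv_Ak : A * SparseRegression.pinv (D.Ak hk) = D.Uk hk * (D.Uk hk)ᵀ := by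
  rw [(isPenroseInverse_pinv _).unique (D.isPenroseInverse_Ak hk), ← Matrix.mul_assoc,
    ← Matrix.mul_assoc, D.mul_Vk, Matrix.mul_assoc (D.Uk hk), diagonal_mul_diagonal]
  simp [(D.s_pos _).ne', sk]

end CompactSVD

/-! ### Norm estimates -/

theorem l2norm_eq {m : ℕ} (v : Fin m → ℝ) : l2norm v = √(v ⬝ᵥ v) := by
  rw [l2norm, EuclideanSpace.norm_eq]
  simp [dotProduct, sq]

theorem l2norm_nonneg {m : ℕ} (v : Fin m → ℝ) : 0 ≤ l2norm v := norm_nonneg _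

theorem l2norm_sq {m : ℕ} (v : Fin m → ℝ) : l2norm v ^ 2 = v ⬝ᵥ v := by
  rw [l2norm_eq, Real.sq_sqrt]
  simpa using dotProduct_star_self_nonneg v

theorem l2norm_add_le {m : ℕ} (v w : Fin m → ℝ) : l2norm (v + w) ≤ l2norm v + l2norm w := by
  simpa [l2norm] using norm_add_le (WithLp.toLp 2 v) (WithLp.toLp 2 w)

theorem dotProduct_le_l2norm_mul {m : ℕ} (v w : Fin m → ℝ) : v ⬝ᵥ w ≤ l2norm v * l2norm w := by
  have := real_inner_le_norm (WithLp.toLp 2 v) (WithLp.toLp 2 w)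
  simpa [l2norm, PiLp.inner_apply, dotProduct, mul_comm] using this

theorem frobNorm_nonneg {m n : ℕ} (M : Matrix (Fin m) (Fin n) ℝ) : 0 ≤ frobNorm M :=
  Real.sqrt_nonneg _

theorem l2norm_mulVec_le {m n : ℕ} (M : Matrix (Fin m) (Fin n) ℝ) (y : Fin n → ℝ) :
    l2norm (M *ᵥ y) ≤ frobNorm M * l2norm y := by
  have h0 : 0 ≤ ∑ i, ∑ j, M i j ^ 2 :=
    Finset.sum_nonneg fun i _ => Finset.sum_nonneg fun j _ => sq_nonneg _
  refine abs_le_of_sq_le_sq' ?_ (mul_nonneg (frobNorm_nonneg _) (l2norm_nonneg _)) |>.2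
  rw [mul_pow, l2norm_sq, l2norm_sq, frobNorm, Real.sq_sqrt h0, Finset.sum_mul]
  refine Finset.sum_le_sum fun i _ => ?_
  have := Finset.sum_mul_sq_le_sq_mul_sq Finset.univ (fun j => M i j) y
  simpa [mulVec, dotProduct, sq] using this

/-- Least squares: `P = C C⁺` is an orthogonal projection fixing the range of `C`, so the left
residual is `(1 - P)(C y - b)` for every `y`. -/
theorem l2norm_mulVec_proj_sub_le {m n : ℕ} (C : Matrix (Fin m) (Fin n) ℝ) (b : Fin m → ℝ)
    (y : Fin n → ℝ) : l2norm (C *ᵥ (pinv C *ᵥ b) - b) ≤ l2norm (C *ᵥ y - b) := by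
  have h := isPenroseInverse_pinv C
  set P := C * pinv C with hP
  have hPP : P * P = P := by rw [hP, ← Matrix.mul_assoc, h.mul_mul]
  have h1 : C *ᵥ (pinv C *ᵥ b) - b = (C *ᵥ y - b) - P *ᵥ (C *ᵥ y - b) := by
    rw [mulVec_sub, mulVec_mulVec, mulVec_mulVec, ← hP, h.mul_mul]
    abel
  have h2 : ∀ w : Fin m → ℝ, (P *ᵥ w) ⬝ᵥ (P *ᵥ w) = w ⬝ᵥ (P *ᵥ w) := fun w => by
    rw [dotProduct_mulVec, vecMul_mulVec, h.symm_left, hPP, ← dotProduct_mulVec]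
  rw [h1, l2norm_eq, l2norm_eq]
  refine Real.sqrt_le_sqrt ?_
  generalize C *ᵥ y - b = w
  rw [sub_dotProduct, dotProduct_sub, dotProduct_sub, h2, dotProduct_comm (P *ᵥ w) w]
  have h3 : 0 ≤ w ⬝ᵥ (P *ᵥ w) := by
    rw [← h2]; simpa using dotProduct_star_self_nonneg (P *ᵥ w)
  linarith

/-- Bessel's inequality, from `0 ≤ ‖b - U Uᵀ b‖² = ‖b‖² - ‖Uᵀ b‖²`. -/
theorem l2norm_transpose_mulVec_le {m k : ℕ} {U : Matrix (Fin m) (Fin k) ℝ} (hU : Uᵀ * U = 1)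
    (b : Fin m → ℝ) : l2norm (Uᵀ *ᵥ b) ≤ l2norm b := by
  rw [l2norm_eq, l2norm_eq]
  refine Real.sqrt_le_sqrt ?_
  have h0 : 0 ≤ (b - U *ᵥ (Uᵀ *ᵥ b)) ⬝ᵥ (b - U *ᵥ (Uᵀ *ᵥ b)) := by
    simpa using dotProduct_star_self_nonneg (b - U *ᵥ (Uᵀ *ᵥ b))
  have h1 : (U *ᵥ (Uᵀ *ᵥ b)) ⬝ᵥ (U *ᵥ (Uᵀ *ᵥ b)) = (Uᵀ *ᵥ b) ⬝ᵥ (Uᵀ *ᵥ b) := by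
    rw [dotProduct_mulVec, vecMul_mulVec, hU, vecMul_one]
  have h2 : b ⬝ᵥ (U *ᵥ (Uᵀ *ᵥ b)) = (Uᵀ *ᵥ b) ⬝ᵥ (Uᵀ *ᵥ b) := by
    rw [dotProduct_mulVec, ← mulVec_transpose]
  rw [sub_dotProduct, dotProduct_sub, dotProduct_sub, h1, h2,
    dotProduct_comm (U *ᵥ (Uᵀ *ᵥ b)) b, h2] at h0
  linarith

theorem l2norm_diagonal_inv_mulVec_le {k : ℕ} {s : Fin k → ℝ} {c : ℝ} (hc : 0 < c)
    (hs : ∀ j, c ≤ s j) (z : Fin k → ℝ) :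
    l2norm (diagonal (fun j => (s j)⁻¹) *ᵥ z) ≤ l2norm z / c := by
  refine abs_le_of_sq_le_sq' ?_ (div_nonneg (l2norm_nonneg _) hc.le) |>.2
  rw [div_pow, l2norm_sq, l2norm_sq, dotProduct, dotProduct, Finset.sum_div]
  refine Finset.sum_le_sum fun j _ => ?_
  rw [mulVec_diagonal]
  have h1 : (s j)⁻¹ ≤ c⁻¹ := inv_anti₀ hc (hs j)
  have h2 : 0 ≤ (s j)⁻¹ := inv_nonneg.mpr (hc.le.trans (hs j))
  calc (s j)⁻¹ * z j * ((s j)⁻¹ * z j) = ((s j)⁻¹ * (s j)⁻¹) * (z j * z j) := by ring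
    _ ≤ (c⁻¹ * c⁻¹) * (z j * z j) := by
        exact mul_le_mul_of_nonneg_right (mul_le_mul h1 h1 h2 (h2.trans h1)) (mul_self_nonneg _)
    _ = _ := by field_simp

/-- The least-norm solution of `W y = z` when `W Wᵀ` is bounded below. -/
theorem exists_mulVec_eq_of_posDef {k r : ℕ} {W : Matrix (Fin k) (Fin r) ℝ} {c : ℝ} (hc : 0 < c)
    (hW : (W * Wᵀ - c • (1 : Matrix (Fin k) (Fin k) ℝ)).PosDef) (z : Fin k → ℝ) :
    ∃ y, W *ᵥ y = z ∧ l2norm y ^ 2 ≤ l2norm z ^ 2 / c := by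
  have hB : (W * Wᵀ).PosDef := by
    have h1 : (c • (1 : Matrix (Fin k) (Fin k) ℝ)).PosDef := by
      rw [smul_one_eq_diagonal, posDef_diagonal_iff]; exact fun _ => hc
    simpa using hW.add h1
  have hu : IsUnit (W * Wᵀ).det := (isUnit_iff_isUnit_det _).mp hB.isUnit
  set w := (W * Wᵀ)⁻¹ *ᵥ z with hw
  have hz : W *ᵥ (Wᵀ *ᵥ w) = z := by
    rw [hw, mulVec_mulVec, mulVec_mulVec, mul_nonsing_inv _ hu, one_mulVec]
  refine ⟨Wᵀ *ᵥ w, hz, ?_⟩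
  have h1 : l2norm (Wᵀ *ᵥ w) ^ 2 = z ⬝ᵥ w := by
    rw [l2norm_sq, dotProduct_mulVec, vecMul_transpose, hz]
  have h2 : c * l2norm w ^ 2 ≤ z ⬝ᵥ w := by
    have := hW.posSemidef.dotProduct_mulVec_nonneg w
    rw [star_trivial, sub_mulVec, dotProduct_sub, smul_mulVec, one_mulVec, dotProduct_smul,
      ← mulVec_mulVec, hz, smul_eq_mul, ← l2norm_sq, dotProduct_comm] at this
    linarith
  have h3 := dotProduct_le_l2norm_mul z w
  rw [h1, le_div_iff₀ hc]
  have h4 := l2norm_nonneg z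
  have h5 := l2norm_nonneg w
  -- Without dividing by `‖w‖`: `‖z‖² ≥ 2c‖z‖‖w‖ - c²‖w‖² ≥ 2c (z ⬝ w) - c (z ⬝ w)`.
  nlinarith [sq_nonneg (l2norm z - c * l2norm w), sq_nonneg (l2norm z), mul_nonneg h4 h5]

/-! ### Extending a run of the sampling procedure -/

theorem accum_congr {k n : ℕ} (Vt : Matrix (Fin k) (Fin n) ℝ) {i i' : ℕ → Fin n} {t t' : ℕ → ℝ} :
    ∀ {N : ℕ}, (∀ τ < N, i τ = i' τ) → (∀ τ < N, t τ = t' τ) → accum Vt i t N = accum Vt i' t' N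
  | 0, _, _ => rfl
  | N + 1, hi, ht => by
    rw [accum, accum, accum_congr Vt (fun τ h => hi τ (h.trans (Nat.lt_succ_self N)))
      fun τ h => ht τ (h.trans (Nat.lt_succ_self N)), hi N (Nat.lt_succ_self N),
      ht N (Nat.lt_succ_self N)]

theorem accum_update {k n : ℕ} (Vt : Matrix (Fin k) (Fin n) ℝ) (i : ℕ → Fin n) (t : ℕ → ℝ)
    {N M : ℕ} (hM : M ≤ N) (i' : Fin n) (t' : ℝ) :
    accum Vt (Function.update i N i') (Function.update t N t') M = accum Vt i t M :=
  accum_congr Vt (fun τ h => Function.update_of_ne (by omega) _ _)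
    fun τ h => Function.update_of_ne (by omega) _ _

/-- The matrices `B_0, …, B_N` depend only on the choices before step `N`, so changing the choice at
`N` leaves the earlier steps valid. -/
theorem SamplingSteps.update {k m n r N : ℕ} {Vt : Matrix (Fin k) (Fin n) ℝ}
    {E : Matrix (Fin m) (Fin n) ℝ} {i : ℕ → Fin n} {t : ℕ → ℝ} (h : SamplingSteps Vt E r N i t)
    {i' : Fin n} {t' : ℝ} (h' : Admissible Vt E r (accum Vt i t N) N i' t') :
    SamplingSteps Vt E r (N + 1) (Function.update i N i') (Function.update t N t') := by
  intro τ hτ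
  rw [accum_update Vt i t (by omega)]
  rcases Nat.lt_succ_iff_lt_or_eq.mp hτ with hlt | rfl
  · rw [Function.update_of_ne hlt.ne, Function.update_of_ne hlt.ne]
    exact h τ hlt
  · rwa [Function.update_self, Function.update_self]

theorem exists_samplingSteps {k m n r : ℕ} (hk : 0 < k) (hkr : k < r)
    {Vt : Matrix (Fin k) (Fin n) ℝ} (hV : Vt * Vtᵀ = 1) {E : Matrix (Fin m) (Fin n) ℝ}
    (hE : frobNorm E ≠ 0) (i₀ : Fin n) : ∀ N, ∃ i t, SamplingSteps Vt E r N i t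
  | 0 => ⟨fun _ => i₀, fun _ => 0, fun _ h => absurd h (Nat.not_lt_zero _)⟩
  | N + 1 => by
    obtain ⟨i, t, h⟩ := exists_samplingSteps hk hkr hV hE i₀ N
    obtain ⟨i', t', h'⟩ := (h.barrierInvariant hk hkr).exists_admissible hk hkr hV hE
    exact ⟨_, _, h.update h'⟩

/-! ### The error of the sampled solution -/

/-- Each column of `Ω` has a single nonzero entry, so no cross terms arise and repeated picks of one
index add their weights. -/
theorem samplingMatrix_mul_diagonal_mul_transpose {n r : ℕ} (i : ℕ → Fin n) (d : Fin r → ℝ) :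
    samplingMatrix r i * diagonal d * (samplingMatrix r i)ᵀ =
      diagonal fun a => ∑ τ : Fin r, if a = i τ then d τ else 0 := by
  ext a b
  rw [mul_apply]
  simp only [mul_diagonal, transpose_apply, samplingMatrix, of_apply, diagonal_apply]
  split_ifs with hab
  · subst hab
    exact Finset.sum_congr rfl fun τ _ => by split_ifs <;> simp
  · refine Finset.sum_eq_zero fun τ _ => ?_
    split_ifs with h1 h2 <;> simp
    exact absurd (h1.trans h2.symm) hab

theorem mul_samplingMatrix_apply {m n r : ℕ} (M : Matrix (Fin m) (Fin n) ℝ) (i : ℕ → Fin n)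
    (a : Fin m) (τ : Fin r) : (M * samplingMatrix r i) a τ = M a (i τ) := by
  simp [mul_apply, samplingMatrix]

/-- For positive weights this exhibits the final matrix as `W Wᵀ` with `W = Vt Ω diag(√t)`, so the
barrier bounds the singular values of `W` from below. -/
theorem accum_eq {k n : ℕ} (Vt : Matrix (Fin k) (Fin n) ℝ) (i : ℕ → Fin n) (t : ℕ → ℝ) :
    ∀ r : ℕ, accum Vt i t r = (Vt * samplingMatrix r i) * diagonal (fun τ : Fin r => t τ) *
      (Vt * samplingMatrix r i)ᵀ
  | 0 => by ext a b; simp [accum, mul_apply]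
  | r + 1 => by
    rw [accum, accum_eq Vt i t r]
    ext a b
    rw [Matrix.add_apply, mul_apply, mul_apply, Fin.sum_univ_castSucc]
    simp only [mul_diagonal, transpose_apply, mul_samplingMatrix_apply, Matrix.smul_apply,
      vecMulVec_apply,
      col_apply, smul_eq_mul, Fin.val_castSucc, Fin.val_last]
    ring

/-- The bound `U(e_i) ≤ 1/t` says that a sampled column has `t ‖e_i‖² ≤ ‖E‖_F² / (1 - √(k/r))`, and
there are `r` of them. The columns are scaled by `√t`, the inverse of the scaling in `S`. -/
theorem frobNorm_sampled_sq_le {k m n r : ℕ} (hkr : k < r)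
    {Vt : Matrix (Fin k) (Fin n) ℝ} {E : Matrix (Fin m) (Fin n) ℝ} {i : ℕ → Fin n} {t : ℕ → ℝ}
    (h : SamplingSteps Vt E r r i t) (hE : frobNorm E ≠ 0) :
    frobNorm (E * samplingMatrix r i * diagonal fun τ : Fin r => √(t τ)) ^ 2 ≤
      r * (frobNorm E ^ 2 / (1 - √((k : ℝ) / r))) := by
  have hs := sqrt_div_lt_one hkr
  have hF : 0 < frobNorm E ^ 2 := by positivity
  rw [frobNorm_sq]
  calc _ ≤ ∑ _τ : Fin r, frobNorm E ^ 2 / (1 - √((k : ℝ) / r)) := by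
        refine Finset.sum_le_sum fun τ _ => ?_
        obtain ⟨ht, hU, -⟩ := h τ τ.2
        have h1 : (E * samplingMatrix r i * diagonal fun τ : Fin r => √(t τ)).col τ =
            √(t τ) • E.col (i τ) := by
          ext a
          simp only [col_apply, mul_diagonal, mul_samplingMatrix_apply, Pi.smul_apply, smul_eq_mul]
          ring
        rw [h1, smul_dotProduct, dotProduct_smul, smul_eq_mul, smul_eq_mul, ← mul_assoc,
          Real.mul_self_sqrt ht.le]
        rw [upperU, div_mul_eq_mul_div, div_le_div_iff₀ hF ht] at hU
        rw [le_div_iff₀ (by linarith)]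
        linarith
    _ = _ := by rw [Finset.sum_const, Finset.card_univ, Fintype.card_fin, nsmul_eq_mul]

/-- Both parts follow from `9k ≤ r ε²`; the constant `9` is the square of the `3` in `ε / 3`. -/
theorem numCols_bound {k : ℕ} (hk : 0 < k) {ε : ℝ} (hε : 0 < ε) (hε' : ε < 1 / 2) :
    k < numCols k ε ∧ √((k : ℝ) / numCols k ε) ≤ ε / 3 := by
  have hk' : (0 : ℝ) < k := by exact_mod_cast hk
  have h1 : 9 * (k : ℝ) / ε ^ 2 ≤ numCols k ε := Nat.le_ceil _
  have h2 : 9 * (k : ℝ) ≤ numCols k ε * ε ^ 2 := by rwa [div_le_iff₀ (by positivity)] at h1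
  have h3 : (k : ℝ) < numCols k ε := by
    have : ε ^ 2 ≤ 1 := by nlinarith
    have : (numCols k ε : ℝ) * ε ^ 2 ≤ numCols k ε * 1 :=
      mul_le_mul_of_nonneg_left this (Nat.cast_nonneg _)
    linarith
  refine ⟨by exact_mod_cast h3, ?_⟩
  rw [Real.sqrt_le_left (by positivity), div_le_iff₀ (hk'.trans h3)]
  nlinarith

/-- With `s = √(k/r)` the final barrier is `r - √(rk) = r (1 - s)`, so `r` cancels in the product
and `z F / (1 - s)` remains; `(1 + ε)(1 - ε/3) ≥ 1` for such small `ε`. -/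
theorem error_factor_le {k r : ℕ} (hk : 0 < k) (hkr : k < r) {ε F z : ℝ} (hε : 0 < ε)
    (hε' : ε < 1 / 2) (hs : √((k : ℝ) / r) ≤ ε / 3) (hF : 0 ≤ F) (hz : 0 ≤ z) {f y : ℝ}
    (hf : f ^ 2 ≤ r * (F ^ 2 / (1 - √((k : ℝ) / r))))
    (hy : y ^ 2 ≤ z ^ 2 / (r - √((r : ℝ) * k))) : f * y ≤ (1 + ε) * z * F := by
  have hr : (0 : ℝ) < r := by exact_mod_cast hk.trans hkr
  set s := √((k : ℝ) / r) with hsdef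
  have hl : (r : ℝ) - √((r : ℝ) * k) = r * (1 - s) := by
    have : √((r : ℝ) * k) = r * s := by
      rw [hsdef, show (r : ℝ) * k = r ^ 2 * (k / r) by field_simp, Real.sqrt_mul (by positivity),
        Real.sqrt_sq hr.le]
    rw [this]; ring
  have hs1 : 0 < 1 - s := by linarith
  rw [hl] at hy
  refine abs_le_of_sq_le_sq' ?_ (by positivity) |>.2
  have h1 : f ^ 2 * y ^ 2 ≤ r * (F ^ 2 / (1 - s)) * (z ^ 2 / (r * (1 - s))) :=
    mul_le_mul hf hy (sq_nonneg _) (by positivity)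
  have h2 : r * (F ^ 2 / (1 - s)) * (z ^ 2 / (r * (1 - s))) = (z * F / (1 - s)) ^ 2 := by
    field_simp
  have h3 : z * F / (1 - s) ≤ (1 + ε) * z * F := by
    rw [div_le_iff₀ hs1]
    have h4 : 1 ≤ (1 + ε) * (1 - s) := by nlinarith
    nlinarith [mul_nonneg hz hF]
  calc (f * y) ^ 2 = f ^ 2 * y ^ 2 := by ring
    _ ≤ (z * F / (1 - s)) ^ 2 := by rw [← h2]; exact h1
    _ ≤ _ := pow_le_pow_left₀ (by positivity) h3 2

theorem l2norm_output_sub_le {m n k : ℕ} {A : Matrix (Fin m) (Fin n) ℝ} (D : CompactSVD A)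
    (b : Fin m → ℝ) {ε : ℝ} (hk₀ : 0 < k) (hk : k < A.rank) (hk' : k - 1 < A.rank)
    (hε : 0 < ε) (hε' : ε < 1 / 2) {x : Fin n → ℝ} (hx : IsSparseRegressionOutput D b hk.le ε x) :
    l2norm (A *ᵥ x - b) ≤ l2norm (A *ᵥ (pinv (D.Ak hk.le) *ᵥ b) - b) +
      (1 + ε) * l2norm b * (frobNorm (A - D.Ak hk.le) / D.s ⟨k - 1, hk'⟩) := by
  obtain ⟨_, _, ⟨i, t, hst, rfl, rfl⟩, rfl⟩ := hx
  obtain ⟨hkr, hs⟩ := numCols_bound hk₀ hε hε'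
  have hE := D.frobNorm_residualMatrix_ne_zero hk.le hk
  set r := numCols k ε
  set Ω := samplingMatrix r i
  set S := rescalingMatrix r t
  set V := D.Vk hk.le
  set U := D.Uk hk.le
  set E := residualMatrix D hk.le
  set T : Matrix (Fin r) (Fin r) ℝ := diagonal fun τ : Fin r => √(t τ) with hT
  have ht : ∀ τ : Fin r, 0 < t τ := fun τ => (hst τ τ.2).1
  have hB := (hst.barrierInvariant hk₀ hkr).1
  have hWW : Vᵀ * Ω * T * (Vᵀ * Ω * T)ᵀ = accum Vᵀ i t r := by
    rw [accum_eq, transpose_mul (Vᵀ * Ω) T, ← Matrix.mul_assoc, hT, diagonal_transpose,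
      Matrix.mul_assoc (Vᵀ * Ω) (diagonal _), diagonal_mul_diagonal]
    simp only [fun τ : Fin r => Real.mul_self_sqrt (ht τ).le]
    rfl
  rw [← hWW] at hB
  have hr : (0 : ℝ) < r := by exact_mod_cast hk₀.trans hkr
  have hbar : 0 < barrier k r r := by
    rw [barrier, sub_pos, Real.sqrt_lt' hr, sq]
    exact mul_lt_mul_of_pos_left (by exact_mod_cast hkr) hr
  -- The target is `Σ_k⁻¹ U_kᵀ b`, so that `U_k Σ_k (V_kᵀ Ω T) y` reproduces `U_k U_kᵀ b = A x_k*`.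
  obtain ⟨y, hy, hy'⟩ := exists_mulVec_eq_of_posDef hbar hB
    (diagonal (fun j => (D.sk hk.le j)⁻¹) *ᵥ (Uᵀ *ᵥ b))
  set σ := D.s ⟨k - 1, hk'⟩ with hσ
  have hσ0 : 0 < σ := D.s_pos _
  have hz : l2norm (diagonal (fun j => (D.sk hk.le j)⁻¹) *ᵥ (Uᵀ *ᵥ b)) ≤ l2norm b / σ := by
    refine (l2norm_diagonal_inv_mulVec_le hσ0 (fun j => D.s_anti ?_) _).trans ?_
    · rw [Fin.le_def]
      have := j.2
      simp only [Fin.val_castLE]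
      omega
    · exact div_le_div_of_nonneg_right (l2norm_transpose_mulVec_le (D.Uk_orth hk.le) b) hσ0.le
  have hz' := pow_le_pow_left₀ (l2norm_nonneg _) hz 2
  have hy'' := hy'.trans (div_le_div_of_nonneg_right hz' hbar.le)
  have hbound := error_factor_le hk₀ hkr hε hε' hs (frobNorm_nonneg E)
    (div_nonneg (l2norm_nonneg b) hσ0.le) (frobNorm_sampled_sq_le hkr hst hE) hy''
  -- The output uses `C = A Ω S` while the estimates concern `Ω T`. The competitor `diag(t) y` links
  -- them, because `(1/√t) t = √t`.
  have hSt : S * (diagonal (fun τ : Fin r => t τ)) = T := by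
    rw [hT]
    simp only [S, rescalingMatrix, diagonal_mul_diagonal]
    congr 1
    ext τ
    have h1 := Real.mul_self_sqrt (ht τ).le
    have h2 := Real.sqrt_pos.mpr (ht τ)
    field_simp
    linarith
  have hAV : A = U * diagonal (D.sk hk.le) * Vᵀ + E := by
    have := D.residualMatrix_eq hk.le
    change A = D.Ak hk.le + residualMatrix D hk.le
    rw [this]; abel
  have hsplit : (A * Ω * S) *ᵥ (diagonal (fun τ : Fin r => t τ) *ᵥ y) - b =
      (A *ᵥ (pinv (D.Ak hk.le) *ᵥ b) - b) + (E * Ω * T) *ᵥ y := by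
    rw [mulVec_mulVec, Matrix.mul_assoc (A * Ω), hSt]
    have h1 : A * Ω * T = U * diagonal (D.sk hk.le) * (Vᵀ * Ω * T) + E * Ω * T := by
      refine (congrArg (fun X => X * Ω * T) hAV).trans ?_
      simp only [Matrix.add_mul, Matrix.mul_assoc]
    rw [h1, add_mulVec, ← mulVec_mulVec, hy, mulVec_mulVec, mulVec_mulVec, mulVec_mulVec,
      D.mul_pinv_Ak, Matrix.mul_assoc U, diagonal_mul_diagonal]
    simp only [fun j => mul_inv_cancel₀ (show D.sk hk.le j ≠ 0 from (D.s_pos _).ne'), diagonal_one,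
      Matrix.mul_one]
    abel
  calc l2norm (A *ᵥ ((Ω * S) *ᵥ (pinv (A * Ω * S) *ᵥ b)) - b)
      = l2norm ((A * Ω * S) *ᵥ (pinv (A * Ω * S) *ᵥ b) - b) := by
        rw [mulVec_mulVec, ← Matrix.mul_assoc]
    _ ≤ l2norm ((A * Ω * S) *ᵥ (diagonal (fun τ : Fin r => t τ) *ᵥ y) - b) :=
        l2norm_mulVec_proj_sub_le _ _ _
    _ ≤ l2norm (A *ᵥ (pinv (D.Ak hk.le) *ᵥ b) - b) + l2norm ((E * Ω * T) *ᵥ y) := by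
        rw [hsplit]; exact l2norm_add_le _ _
    _ ≤ l2norm (A *ᵥ (pinv (D.Ak hk.le) *ᵥ b) - b) + frobNorm (E * Ω * T) * l2norm y :=
        add_le_add_right (l2norm_mulVec_le _ _) _
    _ ≤ _ := by
        rw [← D.residualMatrix_eq hk.le]
        refine add_le_add_right (hbound.trans (le_of_eq ?_)) _
        ring

theorem card_output_ne_zero_le {m n k : ℕ} {A : Matrix (Fin m) (Fin n) ℝ} {D : CompactSVD A}
    {b : Fin m → ℝ} {hk : k ≤ A.rank} {ε : ℝ} {x : Fin n → ℝ}
    (hx : IsSparseRegressionOutput D b hk ε x) :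
    (Finset.univ.filter fun j => x j ≠ 0).card ≤ ⌈9 * (k : ℝ) / ε ^ 2⌉₊ := by
  obtain ⟨_, _, ⟨i, t, hst, rfl, rfl⟩, rfl⟩ := hx
  change _ ≤ numCols k ε
  set r := numCols k ε
  calc _ ≤ (Finset.univ.image fun τ : Fin r => i τ).card := by
        refine Finset.card_le_card fun j hj => ?_
        rw [Finset.mem_filter] at hj
        by_contra hc
        refine hj.2 ?_
        rw [← mulVec_mulVec, mulVec, dotProduct]
        refine Finset.sum_eq_zero fun τ _ => ?_
        -- Row `j` of `Ω` is zero when `j` is never picked, so the output vanishes there whatever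
        -- its coefficients are.
        have : j ≠ i τ := fun h => hc (Finset.mem_image.mpr ⟨τ, Finset.mem_univ _, h.symm⟩)
        simp [samplingMatrix, this]
    _ ≤ (Finset.univ : Finset (Fin r)).card := Finset.card_image_le
    _ = r := by simp

/-- Outputs may be computed from the total squared weights of the columns. -/
theorem output_eq {m n r : ℕ} (A : Matrix (Fin m) (Fin n) ℝ) (i : ℕ → Fin n) {t : ℕ → ℝ}
    (ht : ∀ τ < r, 0 < t τ) :
    samplingMatrix r i * rescalingMatrix r t *
        pinv (A * samplingMatrix r i * rescalingMatrix r t) =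
      diagonal (fun a => √(∑ τ ∈ Finset.range r, if a = i τ then 1 / t τ else 0)) *
        pinv (A * diagonal fun a => √(∑ τ ∈ Finset.range r, if a = i τ then 1 / t τ else 0)) := by
  rw [Matrix.mul_assoc A]
  -- It remains to compare `Ω S Sᵀ Ωᵀ` with the square of the diagonal matrix; both carry the sums
  -- of `1/t` over the picks of each column.
  refine mul_pinv_mul_congr A ?_
  rw [transpose_mul, ← Matrix.mul_assoc, Matrix.mul_assoc (samplingMatrix r i), rescalingMatrix,
    diagonal_transpose, diagonal_transpose, diagonal_mul_diagonal,
    samplingMatrix_mul_diagonal_mul_transpose, diagonal_mul_diagonal]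
  congr 1
  ext a
  rw [Real.mul_self_sqrt, Finset.sum_range fun τ => if a = i τ then 1 / t τ else 0]
  · refine Finset.sum_congr rfl fun τ _ => ?_
    rw [div_mul_div_comm, Real.mul_self_sqrt (ht τ τ.2).le, one_mul]
  · refine Finset.sum_nonneg fun τ hτ => ?_
    have := ht τ (Finset.mem_range.mp hτ)
    split_ifs <;> positivity

/-! ### Program logic -/

namespace Cmd

/-- The program contains an assignment to the natural-number register `y`. -/
def writesNat : Cmd → ℕ → Bool
  | skip, _ => false
  | setNat x _, y => x == y
  | setReal _ _, _ => false
  | setEntry _ _ _ _, _ => false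
  | svd _ _ _ _ _ _ ρ, y => ρ == y
  | seq c d, y => c.writesNat y || d.writesNat y
  | ite _ c d, y => c.writesNat y || d.writesNat y
  | .while _ c, y => c.writesNat y

/-- The program contains an assignment to the real register `y`. -/
def writesReal : Cmd → ℕ → Bool
  | skip, _ => false
  | setNat _ _, _ => false
  | setReal x _, y => x == y
  | setEntry _ _ _ _, _ => false
  | svd _ _ _ _ _ _ _, _ => false
  | seq c d, y => c.writesReal y || d.writesReal y
  | ite _ c d, y => c.writesReal y || d.writesReal y
  | .while _ c, y => c.writesReal y

/-- The program contains an assignment to the array `y`. -/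
def writesArr : Cmd → ℕ → Bool
  | skip, _ => false
  | setNat _ _, _ => false
  | setReal _ _, _ => false
  | setEntry a _ _ _, y => a == y
  | svd _ _ _ u s v _, y => u == y || s == y || v == y
  | seq c d, y => c.writesArr y || d.writesArr y
  | ite _ c d, y => c.writesArr y || d.writesArr y
  | .while _ c, y => c.writesArr y

end Cmd

/-- The memories `st` and `st'` agree wherever `c` does not write. -/
structure Same (c : Cmd) (st st' : Store) : Prop where
  nat : ∀ x, c.writesNat x = false → st'.nat x = st.nat x
  real : ∀ x, c.writesReal x = false → st'.real x = st.real x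
  arr : ∀ a, c.writesArr a = false → st'.arr a = st.arr a

theorem Same.refl (c : Cmd) (st : Store) : Same c st st :=
  ⟨fun _ _ => rfl, fun _ _ => rfl, fun _ _ => rfl⟩

theorem Same.trans {c : Cmd} {s₀ s₁ s₂ : Store} (h : Same c s₀ s₁) (h' : Same c s₁ s₂) :
    Same c s₀ s₂ :=
  ⟨fun x hx => (h'.nat x hx).trans (h.nat x hx), fun x hx => (h'.real x hx).trans (h.real x hx),
    fun x hx => (h'.arr x hx).trans (h.arr x hx)⟩

theorem Same.mono {c d : Cmd} {s₀ s₁ : Store} (h : Same c s₀ s₁)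
    (hn : ∀ x, d.writesNat x = false → c.writesNat x = false)
    (hr : ∀ x, d.writesReal x = false → c.writesReal x = false)
    (ha : ∀ x, d.writesArr x = false → c.writesArr x = false) : Same d s₀ s₁ :=
  ⟨fun x hx => h.nat x (hn x hx), fun x hx => h.real x (hr x hx), fun x hx => h.arr x (ha x hx)⟩

theorem Same.seq_left {c d : Cmd} {s₀ s₁ : Store} (h : Same c s₀ s₁) : Same (.seq c d) s₀ s₁ :=
  h.mono (by simp +contextual [Cmd.writesNat]) (by simp +contextual [Cmd.writesReal])
    (by simp +contextual [Cmd.writesArr])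

theorem Same.seq_right {c d : Cmd} {s₀ s₁ : Store} (h : Same d s₀ s₁) : Same (.seq c d) s₀ s₁ :=
  h.mono (by simp +contextual [Cmd.writesNat]) (by simp +contextual [Cmd.writesReal])
    (by simp +contextual [Cmd.writesArr])

theorem Same.setNat {x : ℕ} {e : NatExp} (st : Store) (c : ℕ) :
    Same (.setNat x e) st (st.setNat x c) := by
  refine ⟨fun y hy => ?_, fun _ _ => rfl, fun _ _ => rfl⟩
  have : y ≠ x := by rintro rfl; simp [Cmd.writesNat] at hy
  simp [Store.setNat, this]

/-- A program changes only what it writes. -/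
theorem Exec.same {svd : SVDRoutine} {c : Cmd} {st st' : Store} {T : ℕ}
    (h : Exec svd c st st' T) : Same c st st' := by
  induction h with
  | skip st => exact Same.refl _ _
  | setNat st x e => exact Same.setNat _ _
  | setReal st x e =>
    refine ⟨fun _ _ => rfl, fun y hy => ?_, fun _ _ => rfl⟩
    have : y ≠ x := by rintro rfl; simp [Cmd.writesReal] at hy
    simp [Store.setReal, this]
  | setEntry st a i j e =>
    refine ⟨fun _ _ => rfl, fun _ _ => rfl, fun y hy => ?_⟩
    have : y ≠ a := by rintro rfl; simp [Cmd.writesArr] at hy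
    simp [Store.setEntry, this]
  | svd st p q a u s v ρ =>
    refine ⟨fun y hy => ?_, fun _ _ => rfl, fun y hy => ?_⟩
    · have : y ≠ ρ := by rintro rfl; simp [Cmd.writesNat] at hy
      simp [Store.setSVD, Store.setNat, Store.setBlock, this]
    · have h1 : y ≠ u ∧ y ≠ s ∧ y ≠ v := by
        refine ⟨?_, ?_, ?_⟩ <;> rintro rfl <;> simp [Cmd.writesArr] at hy
      simp [Store.setSVD, Store.setNat, Store.setBlock, h1]
  | seq c d _ _ _ _ _ _ _ h1 h2 => exact h1.seq_left.trans h2.seq_right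
  | ite_true b c d _ _ _ _ _ h1 => exact (h1.seq_left (d := d)).mono (fun _ => id) (fun _ => id) fun _ => id
  | ite_false b c d _ _ _ _ _ h1 => exact (h1.seq_right (c := c)).mono (fun _ => id) (fun _ => id) fun _ => id
  | while_true b c _ _ _ _ _ _ _ _ h1 h2 =>
    exact Same.trans ⟨h1.nat, h1.real, h1.arr⟩ h2
  | while_false => exact Same.refl _ _

/-- Started in `st`, the program `c` halts after at most `N` steps, and then `Q` holds. -/
def Runs (svd : SVDRoutine) (c : Cmd) (st : Store) (N : ℕ) (Q : Store → Prop) : Prop :=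
  ∃ st' T, Exec svd c st st' T ∧ T ≤ N ∧ Q st'

namespace Runs

variable {svd : SVDRoutine} {c d : Cmd} {st : Store} {N N' : ℕ} {Q R : Store → Prop}

/-- The rule of consequence also supplies `Same`, so postconditions need only mention what a block
computes. -/
theorem mono (h : Runs svd c st N R) (hN : N ≤ N') (hQ : ∀ s, Same c st s → R s → Q s) :
    Runs svd c st N' Q := by
  obtain ⟨s, T, he, hT, hR⟩ := h
  exact ⟨s, T, he, hT.trans hN, hQ s he.same hR⟩

theorem imp (h : Runs svd c st N R) (hQ : ∀ s, Same c st s → R s → Q s) : Runs svd c st N Q :=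
  h.mono le_rfl hQ

theorem le (h : Runs svd c st N Q) (hN : N ≤ N') : Runs svd c st N' Q :=
  h.mono hN fun _ _ => id

theorem seq (h : Runs svd c st N R) (h' : ∀ s, Same c st s → R s → Runs svd d s N' Q) :
    Runs svd (.seq c d) st (N + N') Q := by
  obtain ⟨s, T, he, hT, hR⟩ := h
  obtain ⟨s', T', he', hT', hQ⟩ := h' s he.same hR
  exact ⟨s', T + T', .seq _ _ _ _ _ _ _ he he', add_le_add hT hT', hQ⟩

theorem skip (h : Q st) : Runs svd .skip st 1 Q := ⟨_, _, .skip _, le_rfl, h⟩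

theorem setNat {x : ℕ} {e : NatExp} (h : Q (st.setNat x (e.eval st))) :
    Runs svd (.setNat x e) st (e.cost + 1) Q := ⟨_, _, .setNat _ _ _, le_rfl, h⟩

theorem setReal {x : ℕ} {e : RealExp} (h : Q (st.setReal x (e.eval st))) :
    Runs svd (.setReal x e) st (e.cost + 1) Q := ⟨_, _, .setReal _ _ _, le_rfl, h⟩

theorem setEntry {a : ℕ} {i j : NatExp} {e : RealExp}
    (h : Q (st.setEntry a (i.eval st) (j.eval st) (e.eval st))) :
    Runs svd (.setEntry a i j e) st (i.cost + j.cost + e.cost + 1) Q :=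
  ⟨_, _, .setEntry _ _ _ _ _, le_rfl, h⟩

theorem ite {b : Test} (h : b.Holds st → Runs svd c st N Q) (h' : ¬ b.Holds st → Runs svd d st N Q) :
    Runs svd (.ite b c d) st (b.cost + N) Q := by
  by_cases hb : b.Holds st
  · obtain ⟨s, T, he, hT, hQ⟩ := h hb
    exact ⟨s, _, .ite_true _ _ _ _ _ _ hb he, by omega, hQ⟩
  · obtain ⟨s, T, he, hT, hQ⟩ := h' hb
    exact ⟨s, _, .ite_false _ _ _ _ _ _ hb he, by omega, hQ⟩

/-- A loop that runs `N` times. -/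
theorem while_count {b : Test} {C : ℕ} (inv : ℕ → Store → Prop) (N : ℕ)
    (hstep : ∀ i < N, ∀ s, Same c st s → inv i s → b.Holds s ∧ Runs svd c s C (inv (i + 1)))
    (hend : ∀ s, Same c st s → inv N s → ¬ b.Holds s) (h₀ : inv 0 st) :
    Runs svd (.while b c) st (N * (b.cost + C) + b.cost) (inv N) := by
  -- Induction on the number `j` of iterations still to come.
  have key : ∀ j ≤ N, ∀ s, Same c st s → inv (N - j) s →
      Runs svd (.while b c) s (j * (b.cost + C) + b.cost) (inv N) := by
    intro j
    induction j with
    | zero =>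
      intro _ s hs hi
      exact ⟨s, _, .while_false _ _ _ (hend s hs hi), by omega, hi⟩
    | succ j ih =>
      intro hj s hs hi
      obtain ⟨hb, s₁, T₁, he₁, hT₁, hi₁⟩ := hstep _ (by omega) s hs hi
      have hidx : N - (j + 1) + 1 = N - j := by omega
      rw [hidx] at hi₁
      obtain ⟨s₂, T₂, he₂, hT₂, hQ⟩ := ih (by omega) s₁ (hs.trans he₁.same) hi₁
      refine ⟨s₂, _, .while_true _ _ _ _ _ _ _ hb he₁ he₂, ?_, hQ⟩
      rw [Nat.succ_mul]
      omega
  exact key N le_rfl st (Same.refl _ _) (by simpa using h₀)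

end Runs

/-- `for x = 0, …, e - 1 do c`. -/
def forLoop (x : ℕ) (e : NatExp) (c : Cmd) : Cmd :=
  .seq (.setNat x (.lit 0))
    (.while (.natLt (.var x) e) (.seq c (.setNat x (.add (.var x) (.lit 1)))))

theorem Same.forLoop_body {x : ℕ} {e : NatExp} {c : Cmd} {s s' : Store} (h : Same c s s') :
    Same (forLoop x e c) s s' :=
  Same.seq_right (Same.mono (Same.seq_left (d := .setNat x (.add (.var x) (.lit 1))) h)
    (fun _ => id) (fun _ => id) fun _ => id)

/-- Besides `C + e.cost`, an iteration spends 2 steps on the rest of the test and 4 on the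
increment; initialising the counter and the failing last test account for `e.cost + 4`. The bound
`e` is re-evaluated at each test, hence `he` for every memory that agrees outside the write set. -/
theorem runs_forLoop {svd : SVDRoutine} {x : ℕ} {e : NatExp} {c : Cmd} {st : Store}
    (inv : ℕ → Store → Prop) (N : ℕ) {C : ℕ} (hx : c.writesNat x = false)
    (he : ∀ s, Same (forLoop x e c) st s → e.eval s = N) (h₀ : inv 0 (st.setNat x 0))
    (hstep : ∀ i < N, ∀ s, Same (forLoop x e c) st s → s.nat x = i → inv i s →
      Runs svd c s C fun s' => inv (i + 1) (s'.setNat x (i + 1))) :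
    Runs svd (forLoop x e c) st (N * (C + e.cost + 6) + (e.cost + 4)) (inv N) := by
  have h := Runs.seq (N := 2) (N' := N * (e.cost + 2 + (C + 4)) + (e.cost + 2))
    (Q := fun s => s.nat x = N ∧ inv N s)
    (c := .setNat x (.lit 0))
    (d := .while (.natLt (.var x) e) (.seq c (.setNat x (.add (.var x) (.lit 1)))))
    (R := fun s => s = st.setNat x 0) (svd := svd) (st := st)
    (Runs.setNat rfl) (by
      rintro _ hs₀ rfl
      have hsame : ∀ s, Same (.seq c (.setNat x (.add (.var x) (.lit 1)))) (st.setNat x 0) s →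
          Same (forLoop x e c) st s := fun s hs =>
        (Same.seq_left hs₀).trans (Same.seq_right ⟨hs.nat, hs.real, hs.arr⟩)
      have := Runs.while_count (svd := svd) (b := .natLt (.var x) e)
        (c := .seq c (.setNat x (.add (.var x) (.lit 1)))) (st := st.setNat x 0) (C := C + 4)
        (fun i s => s.nat x = i ∧ inv i s) N ?_ ?_ ?_
      · have hc : Test.cost (.natLt (.var x) e) = e.cost + 2 := by
          simp only [Test.cost, NatExp.cost]; omega
        rw [hc] at this
        exact this
      · rintro i hi s hs ⟨hsx, hinv⟩
        constructor
        · simp only [Test.Holds, NatExp.eval]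
          rw [he s (hsame s hs), hsx]
          exact hi
        · refine (hstep i hi s (hsame s hs) hsx hinv).seq fun s' hs' hinv' => ?_
          refine Runs.setNat (e := .add (.var x) (.lit 1)) ?_
          have : s'.nat x = i := (hs'.nat x hx).trans hsx
          simp only [NatExp.eval, this]
          exact ⟨by simp [Store.setNat], hinv'⟩
      · rintro s hs ⟨hsx, -⟩
        simp only [Test.Holds, NatExp.eval]
        rw [he s (hsame s hs), hsx]
        exact lt_irrefl _
      · exact ⟨by simp [Store.setNat], h₀⟩)
  refine h.mono (le_of_eq ?_) fun s _ hs => hs.2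
  have : e.cost + 2 + (C + 4) = C + e.cost + 6 := by omega
  rw [this]
  omega

/-! ### Loops that accumulate sums and fill arrays -/

theorem Store.setNat_arr (st : Store) (x c : ℕ) : (st.setNat x c).arr = st.arr := rfl

theorem Store.setReal_real_self (st : Store) (x : ℕ) (c : ℝ) : (st.setReal x c).real x = c := by
  simp [Store.setReal]

theorem Store.setEntry_arr (st : Store) (a i j : ℕ) (c : ℝ) (i' j' : ℕ) :
    (st.setEntry a i j c).arr a i' j' = if i' = i ∧ j' = j then c else st.arr a i' j' := by
  simp only [Store.setEntry, Function.update_self, Function.update_apply]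
  split_ifs <;> simp_all

theorem Store.setEntry_arr_of_ne (st : Store) {a a' : ℕ} (h : a' ≠ a) (i j : ℕ) (c : ℝ) :
    (st.setEntry a i j c).arr a' = st.arr a' := by
  simp [Store.setEntry, h]

theorem runs_sumLoop {svd : SVDRoutine} {x y : ℕ} {e : NatExp} {c : Cmd} {st : Store} (f : ℕ → ℝ)
    (N : ℕ) {C : ℕ} (hx : c.writesNat x = false)
    (he : ∀ s, Same (forLoop x e c) st s → e.eval s = N)
    (hstep : ∀ i < N, ∀ s, Same (forLoop x e c) st s → s.nat x = i →
      Runs svd c s C fun s' => s'.real y = s.real y + f i) :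
    Runs svd (forLoop x e c) st (N * (C + e.cost + 6) + (e.cost + 4))
      fun s => s.real y = st.real y + ∑ i ∈ Finset.range N, f i := by
  refine runs_forLoop (fun i s => s.real y = st.real y + ∑ i ∈ Finset.range i, f i) N hx he
    (by simp [Store.setNat]) fun i hi s hs hsx hinv => ?_
  refine (hstep i hi s hs hsx).imp fun s' _ hs' => ?_
  change s'.real y = _
  rw [hs', hinv, Finset.sum_range_succ, add_assoc]

/-- `y := y + ∑_{x < e} t`. -/
def sumTo (y x : ℕ) (e : NatExp) (t : RealExp) : Cmd :=
  forLoop x e (.setReal y (.add (.var y) t))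

theorem runs_sumTo {svd : SVDRoutine} {x y : ℕ} {e : NatExp} {t : RealExp} {st : Store}
    (f : ℕ → ℝ) (N : ℕ) (he : ∀ s, Same (sumTo y x e t) st s → e.eval s = N)
    (ht : ∀ i < N, ∀ s, Same (sumTo y x e t) st s → s.nat x = i →
      t.eval s = f i) :
    Runs svd (sumTo y x e t) st (N * (t.cost + 3 + e.cost + 6) + (e.cost + 4))
      fun s => s.real y = st.real y + ∑ i ∈ Finset.range N, f i := by
  refine runs_sumLoop f N rfl he fun i hi s hs hsx => ?_
  refine (Runs.setReal ?_).le (N := (RealExp.add (.var y) t).cost + 1) ?_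
  · rw [Store.setReal_real_self, RealExp.eval, ht i hi s hs hsx, RealExp.eval]
  · simp only [RealExp.cost]; omega

/-- Fill column `0` of the array `a`: for all `x < e`, put `y := ∑_{z < e'} t` and write `w` into
entry `x`. -/
def fillCol (a x : ℕ) (e : NatExp) (y z : ℕ) (e' : NatExp) (t w : RealExp) : Cmd :=
  forLoop x e (.seq (.setReal y (.ofNat (.lit 0)))
    (.seq (sumTo y z e' t) (.setEntry a (.var x) (.lit 0) w)))

theorem runs_fillCol {svd : SVDRoutine} {a x y z : ℕ} {e e' : NatExp} {t w : RealExp} {st : Store}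
    (f : ℕ → ℕ → ℝ) (g : ℕ → ℝ → ℝ) (N N' : ℕ) (hxz : x ≠ z)
    (he : ∀ s, Same (fillCol a x e y z e' t w) st s → e.eval s = N)
    (he' : ∀ s, Same (fillCol a x e y z e' t w) st s → e'.eval s = N')
    (ht : ∀ i < N, ∀ j < N', ∀ s, Same (fillCol a x e y z e' t w) st s →
      s.nat x = i → s.nat z = j → t.eval s = f i j)
    (hw : ∀ i < N, ∀ s, Same (fillCol a x e y z e' t w) st s →
      s.nat x = i → w.eval s = g i (s.real y)) :
    Runs svd (fillCol a x e y z e' t w) st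
      (N * ((N' * (t.cost + 3 + e'.cost + 6) + (e'.cost + w.cost + 10)) + e.cost + 6) +
        (e.cost + 4))
      fun s => ∀ i < N, s.arr a i 0 = g i (∑ j ∈ Finset.range N', f i j) := by
  have hzx : (z == x) = false := by simpa using hxz.symm
  set c₁ : Cmd := .setReal y (.ofNat (.lit 0))
  set c₂ : Cmd := sumTo y z e' t
  set c₃ : Cmd := .setEntry a (.var x) (.lit 0) w
  have hcx : (Cmd.seq c₁ (.seq c₂ c₃)).writesNat x = false := by
    simp [c₁, c₂, c₃, Cmd.writesNat, sumTo, forLoop, hzx]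
  refine runs_forLoop (fun i s => ∀ i' < i, s.arr a i' 0 = g i' (∑ j ∈ Finset.range N', f i' j))
    N hcx he (fun _ h => absurd h (Nat.not_lt_zero _)) fun i hi s hs hsx hinv => ?_
  have hsub : ∀ {s'}, Same (.seq c₁ (.seq c₂ c₃)) s s' → Same (fillCol a x e y z e' t w) st s' :=
    fun h => hs.trans h.forLoop_body
  have hN : ∀ {s'}, Same (.seq c₁ (.seq c₂ c₃)) s s' → s'.nat x = i :=
    fun h => (h.nat x hcx).trans hsx
  refine Runs.le (N := 3 + ((N' * (t.cost + 3 + e'.cost + 6) + (e'.cost + 4)) + (w.cost + 3))) ?_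
    (by omega)
  refine Runs.seq (R := fun s₁ => s₁.real y = 0) (Runs.setReal ?_) fun s₁ hs₁ hy => ?_
  · simp [Store.setReal_real_self, RealExp.eval, NatExp.eval]
  have h₁ : ∀ {s'}, Same c₂ s₁ s' → Same (.seq c₁ (.seq c₂ c₃)) s s' := fun h =>
    hs₁.seq_left.trans h.seq_left.seq_right
  refine Runs.seq (runs_sumTo (f i) N' (fun s₂ hs₂ => he' s₂ (hsub (h₁ hs₂)))
    fun j hj s₂ hs₂ hz => ht i hi j hj s₂ (hsub (h₁ hs₂)) (hN (h₁ hs₂)) hz) fun s₂ hs₂ hy₂ => ?_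
  refine (Runs.setEntry ?_).le (N := 1 + 1 + w.cost + 1) (by omega)
  intro i' hi'
  rw [Store.setNat_arr, Store.setEntry_arr]
  simp only [NatExp.eval, hN (h₁ hs₂), and_true]
  split_ifs with hii
  · rw [hw i hi s₂ (hsub (h₁ hs₂)) (hN (h₁ hs₂)), hii, hy₂, hy, zero_add]
  · rw [hs₂.arr a (by simp [Cmd.writesArr, sumTo, forLoop]), hs₁.arr a rfl]
    exact hinv i' (by omega)

/-- For all `x < e` and `y < e'`, write `t` into entry `(x, y)` of the array `a`. -/
def fillArr (a x y : ℕ) (e e' : NatExp) (t : RealExp) : Cmd :=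
  forLoop x e (forLoop y e' (.setEntry a (.var x) (.var y) t))

/-- `ht` may assume that the entry about to be written still has its old value. This permits
in-place updates, such as adding a rank-one matrix. -/
theorem runs_fillArr {svd : SVDRoutine} {a x y : ℕ} {e e' : NatExp} {t : RealExp} {st : Store}
    (f : ℕ → ℕ → ℝ) (N N' : ℕ) (hxy : x ≠ y)
    (he : ∀ s, Same (fillArr a x y e e' t) st s → e.eval s = N)
    (he' : ∀ s, Same (fillArr a x y e e' t) st s → e'.eval s = N')
    (ht : ∀ i < N, ∀ j < N', ∀ s, Same (fillArr a x y e e' t) st s → s.nat x = i → s.nat y = j →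
      s.arr a i j = st.arr a i j → t.eval s = f i j) :
    Runs svd (fillArr a x y e e' t) st
      (N * ((N' * (t.cost + 3 + e'.cost + 6) + (e'.cost + 4)) + e.cost + 6) + (e.cost + 4))
      fun s => ∀ i < N, ∀ j < N', s.arr a i j = f i j := by
  have hyx : (y == x) = false := by simpa using hxy.symm
  set c : Cmd := .setEntry a (.var x) (.var y) t with hc
  have hcx : (forLoop y e' c).writesNat x = false := by
    simp [c, Cmd.writesNat, forLoop, hyx]
  refine (runs_forLoop (fun i s => ∀ i' j', s.arr a i' j' =
    if i' < i ∧ j' < N' then f i' j' else st.arr a i' j') N hcx he (by simp [Store.setNat])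
    fun i hi s hs hsx hinv => ?_).imp fun s _ hs i hi j hj => by simp [hs, hi, hj]
  -- Entries before `(i, j)` in row-major order are new, all others are untouched.
  refine (runs_forLoop (fun j s' => ∀ i' j', s'.arr a i' j' =
    if i' < i ∧ j' < N' ∨ i' = i ∧ j' < j then f i' j' else st.arr a i' j') N' rfl
    (fun s' hs' => he' s' (hs.trans hs'.forLoop_body)) ?_
    fun j hj s' hs' hsy hinv' => ?_).imp fun s' hs' h i' j' => ?_
  · intro i' j'
    change s.arr a i' j' = _
    simp [hinv]
  · have hx : s'.nat x = i := (hs'.nat x hcx).trans hsx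
    refine (Runs.setEntry ?_).le (N := 1 + 1 + t.cost + 1) (by omega)
    intro i' j'
    rw [Store.setNat_arr, Store.setEntry_arr]
    simp only [NatExp.eval, hx, hsy]
    have hij := hinv' i j
    rw [if_neg (by omega)] at hij
    rw [ht i hi j hj s' (hs.trans hs'.forLoop_body) hx hsy hij, hinv']
    by_cases h1 : i' = i ∧ j' = j
    · rw [if_pos h1, if_pos (by omega), h1.1, h1.2]
    · rw [if_neg h1]
      congr 1
      apply propext
      omega
  · change s'.arr a i' j' = _
    rw [h]
    congr 1
    apply propext
    omega

/-! ### Singular value decompositions in the memory -/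

/-- The arrays `u`, `σ`, `v` and the register `ρ` hold the decomposition `D`. -/
structure HoldsSVD (s : Store) (u σ v ρ : ℕ) {p q : ℕ} {M : Matrix (Fin p) (Fin q) ℝ}
    (D : CompactSVD M) : Prop where
  rank : s.nat ρ = M.rank
  left : ∀ (i : Fin p) (j : Fin M.rank), s.arr u i j = D.U i j
  sing : ∀ j : Fin M.rank, s.arr σ 0 j = D.s j
  right : ∀ (i : Fin q) (j : Fin M.rank), s.arr v i j = D.V i j

theorem HoldsSVD.congr {s s' : Store} {u σ v ρ p q : ℕ} {M : Matrix (Fin p) (Fin q) ℝ}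
    {D : CompactSVD M} (h : HoldsSVD s u σ v ρ D) (hu : s'.arr u = s.arr u)
    (hσ : s'.arr σ = s.arr σ) (hv : s'.arr v = s.arr v) (hρ : s'.nat ρ = s.nat ρ) :
    HoldsSVD s' u σ v ρ D :=
  ⟨by rw [hρ, h.rank], by rw [hu]; exact h.left, by rw [hσ]; exact h.sing,
    by rw [hv]; exact h.right⟩

theorem holdsSVD_setSVD (st : Store) {u σ v ρ : ℕ} (huσ : u ≠ σ) (huv : u ≠ v) (hσv : σ ≠ v)
    {p q : ℕ} {M : Matrix (Fin p) (Fin q) ℝ} (D : CompactSVD M) :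
    HoldsSVD (st.setSVD u σ v ρ D) u σ v ρ D := by
  refine ⟨?_, fun i j => ?_, fun j => ?_, fun i j => ?_⟩
  · simp [Store.setSVD, Store.setNat]
  · simp [Store.setSVD, Store.setNat, Store.setBlock, writeBlock, huσ, huv]
  · simp [Store.setSVD, Store.setNat, Store.setBlock, writeBlock, hσv]
  · simp [Store.setSVD, Store.setNat, Store.setBlock, writeBlock]

theorem runs_svd {svd : SVDRoutine} {st : Store} {x y a u σ v ρ : ℕ} (huσ : u ≠ σ) (huv : u ≠ v)
    (hσv : σ ≠ v) {p q : ℕ} (hx : st.nat x = p) (hy : st.nat y = q)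
    {M : Matrix (Fin p) (Fin q) ℝ} (hM : readBlock (st.arr a) p q = M) :
    Runs svd (.svd (.var x) (.var y) a u σ v ρ) st (p * q * min p q + 3)
      fun s => HoldsSVD s u σ v ρ (svd p q M) := by
  subst hx hy hM
  refine ⟨_, _, .svd st (.var x) (.var y) a u σ v ρ, ?_, ?_⟩
  · simp only [NatExp.cost, NatExp.eval]; omega
  · exact holdsSVD_setSVD st huσ huv hσv _

/-! ### Inverses in terms of singular value decompositions -/

namespace CompactSVD

variable {k : ℕ} {M : Matrix (Fin k) (Fin k) ℝ} (D : CompactSVD M)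

/-- Read off from `M⁻¹ = V Σ⁻¹ Uᵀ`; given the decomposition, `O(k²)` operations suffice. -/
theorem trace_inv (hM : IsUnit M.det) :
    M⁻¹.trace = ∑ a, ∑ b, D.U a b * D.V a b / D.s b := by
  rw [← D.pinv_eq_inv hM, CompactSVD.pinv, trace]
  refine Finset.sum_congr rfl fun a _ => ?_
  rw [diag_apply, mul_apply]
  refine Finset.sum_congr rfl fun b _ => ?_
  rw [mul_diagonal, transpose_apply]
  ring

theorem dotProduct_inv_mulVec (hM : IsUnit M.det) (v : Fin k → ℝ) :
    v ⬝ᵥ (M⁻¹ *ᵥ v) = ∑ b, (∑ a, v a * D.V a b) * (∑ a, v a * D.U a b) / D.s b := by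
  rw [← D.pinv_eq_inv hM, CompactSVD.pinv, ← mulVec_mulVec, ← mulVec_mulVec, dotProduct_mulVec,
    dotProduct]
  refine Finset.sum_congr rfl fun b _ => ?_
  rw [mulVec_diagonal, mulVec, vecMul, dotProduct, dotProduct]
  simp only [transpose_apply, mul_comm (D.U _ _)]
  ring

/-- By symmetry `M⁻² = M⁻¹ (M⁻¹)ᵀ = V Σ⁻² Vᵀ`, so the left singular vectors drop out. -/
theorem dotProduct_inv_sq_mulVec (hM : IsUnit M.det) (hs : Mᵀ = M) (v : Fin k → ℝ) :
    v ⬝ᵥ ((M⁻¹ ^ 2) *ᵥ v) =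
      ∑ b, (∑ a, v a * D.V a b) * (∑ a, v a * D.V a b) / (D.s b * D.s b) := by
  have h1 : M⁻¹ ^ 2 = D.V * diagonal (fun b => (D.s b * D.s b)⁻¹) * D.Vᵀ := by
    have h2 : M⁻¹ = (M⁻¹)ᵀ := by rw [transpose_nonsing_inv, hs]
    rw [sq]
    conv_lhs => rhs; rw [h2]
    rw [← D.pinv_eq_inv hM, CompactSVD.pinv, transpose_mul, transpose_mul, transpose_transpose,
      diagonal_transpose]
    calc _ = D.V * (diagonal (fun j => (D.s j)⁻¹) * (D.Uᵀ * D.U) *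
          diagonal (fun j => (D.s j)⁻¹)) * D.Vᵀ := by simp only [Matrix.mul_assoc]
      _ = _ := by rw [D.U_orth, Matrix.mul_one, diagonal_mul_diagonal]; simp only [mul_inv]
  rw [h1, ← mulVec_mulVec, ← mulVec_mulVec, dotProduct_mulVec, dotProduct]
  refine Finset.sum_congr rfl fun b _ => ?_
  rw [mulVec_diagonal, mulVec, vecMul, dotProduct, dotProduct]
  simp only [transpose_apply, mul_comm (D.V _ _)]
  ring

end CompactSVD

/-! ### The blocks of the program

Registers: `m`, `n`, `k`, `r`, `rank A` are kept in the natural-number registers `0` to `4`, the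
loop counters are `5` to `8`, the chosen column is `9`, and `10` holds the rank returned by
auxiliary decompositions. Arrays: `3`, `4`, `5` hold the decomposition of `A`, column `0` of `6` the
squared column norms of the residual, `7` the shifted matrix `B - l`, the arrays `8`, `9`, `10` an
auxiliary decomposition, column `0` of `11` the total squared weights of the columns, `12` the
matrix `A` with reweighted columns, and column `0` of `13` the coefficients of its solution. -/

/-- Decompose the matrix in the array `7` and write the trace of its inverse into `y`. -/
def invTrace (y : ℕ) : Cmd :=
  .seq (.svd (.var 2) (.var 2) 7 8 9 10 10) (.seq (.setReal y (.ofNat (.lit 0)))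
    (forLoop 7 (.var 2) (sumTo y 8 (.var 10)
      (.div (.mul (.entry 8 (.var 7) (.var 8)) (.entry 10 (.var 7) (.var 8)))
        (.entry 9 (.lit 0) (.var 8))))))

theorem runs_invTrace {svd : SVDRoutine} {st : Store} {y k : ℕ} (hk : 0 < k) (h2 : st.nat 2 = k)
    {M : Matrix (Fin k) (Fin k) ℝ} (hM : readBlock (st.arr 7) k k = M) (hdet : IsUnit M.det) :
    Runs svd (invTrace y) st (100 * (k * k * k)) fun s =>
      HoldsSVD s 8 9 10 10 (svd k k M) ∧ s.real y = M⁻¹.trace := by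
  have hcost : k * k * min k k + 3 +
      (3 + (k * ((M.rank * (11 + 3 + 1 + 6) + (1 + 4)) + 1 + 6) + (1 + 4))) ≤
      100 * (k * k * k) := by
    have h1 : M.rank ≤ k := M.rank_le_width
    have h2 : M.rank * k ≤ k * k := Nat.mul_le_mul_right k h1
    have h3 : k ≤ k * k := Nat.le_mul_of_pos_left _ hk
    have h4 : k * k ≤ k * k * k := Nat.le_mul_of_pos_right _ hk
    rw [min_self]
    linarith
  refine Runs.le ?_ hcost
  refine Runs.seq (runs_svd (by decide) (by decide) (by decide) h2 h2 hM) fun s₁ hs₁ hD => ?_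
  refine Runs.seq (R := fun s => s.real y = 0) (Runs.setReal ?_) fun s₂ hs₂ hy => ?_
  · simp [Store.setReal_real_self, RealExp.eval, NatExp.eval]
  have hD₂ := hD.congr (hs₂.arr 8 rfl) (hs₂.arr 9 rfl) (hs₂.arr 10 rfl) (hs₂.nat 10 rfl)
  have hk₂ : s₂.nat 2 = k := by rw [hs₂.nat 2 rfl, hs₁.nat 2 rfl, h2]
  refine (runs_sumLoop (y := y) (e := .var 2) (fun a => ∑ b ∈ Finset.range M.rank,
    s₂.arr 8 a b * s₂.arr 10 a b / s₂.arr 9 0 b) k rfl (fun s hs => (hs.nat 2 rfl).trans hk₂)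
    fun a ha s hs hsa => runs_sumTo (e := .var 10) _ M.rank
      (fun s' hs' => (hs'.nat 10 rfl).trans ((hs.nat 10 rfl).trans hD₂.rank))
      fun b hb s' hs' hsb => ?_).imp fun s hs hsum => ⟨?_, ?_⟩
  · have e7 : s'.nat 7 = a := (hs'.nat 7 rfl).trans hsa
    have h := hs.trans hs'.forLoop_body
    simp only [RealExp.eval, NatExp.eval, e7, hsb, h.arr 8 rfl, h.arr 9 rfl, h.arr 10 rfl]
  · exact hD₂.congr (hs.arr 8 rfl) (hs.arr 9 rfl) (hs.arr 10 rfl) (hs.nat 10 rfl)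
  · rw [hsum, hy, zero_add, (svd k k M).trace_inv hdet, Finset.sum_range]
    refine Finset.sum_congr rfl fun a _ => ?_
    rw [Finset.sum_range]
    refine Finset.sum_congr rfl fun b _ => ?_
    rw [hD₂.left, hD₂.right, hD₂.sing]

/-- Add `e` to the diagonal of the matrix in the array `7`. -/
def diagShift (e : RealExp) : Cmd :=
  forLoop 7 (.var 2) (.setEntry 7 (.var 7) (.var 7) (.add (.entry 7 (.var 7) (.var 7)) e))

theorem runs_diagShift {svd : SVDRoutine} {st : Store} {e : RealExp} {k : ℕ} (h2 : st.nat 2 = k)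
    {c : ℝ} (he : ∀ s, Same (diagShift e) st s → e.eval s = c) :
    Runs svd (diagShift e) st (k * (e.cost + 14) + 5) fun s =>
      readBlock (s.arr 7) k k = readBlock (st.arr 7) k k + c • 1 := by
  refine Runs.mono (runs_forLoop (C := e.cost + 7) (fun l s => ∀ i j, s.arr 7 i j =
    st.arr 7 i j + if i = j ∧ i < l then c else 0) k rfl (fun s hs => (hs.nat 2 rfl).trans h2)
    (by simp [Store.setNat]) fun l hl s hs hsl hinv => ?_) ?_ fun s _ hs => ?_
  · refine (Runs.setEntry ?_).le ?_
    · intro i j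
      rw [Store.setNat_arr, Store.setEntry_arr]
      simp only [NatExp.eval, RealExp.eval, hsl, he s hs, hinv]
      by_cases hi : i = l ∧ j = l
      · simp [hi]
      · rw [if_neg hi]
        congr 2
        apply propext
        omega
    · simp only [NatExp.cost, RealExp.cost]; omega
  · exact le_of_eq rfl
  · ext i j
    simp [readBlock, hs, Matrix.one_apply, Fin.ext_iff]

/-- Compute the lower bound for the column in the register `6`. -/
def lowerBound : Cmd :=
  .seq (.setReal 6 (.ofNat (.lit 0))) (.seq (.setReal 7 (.ofNat (.lit 0)))
    (.seq (forLoop 8 (.var 10)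
      (.seq (.setReal 2 (.ofNat (.lit 0)))
      (.seq (sumTo 2 7 (.var 2) (.mul (.entry 5 (.var 6) (.var 7)) (.entry 10 (.var 7) (.var 8))))
      (.seq (.setReal 3 (.ofNat (.lit 0)))
      (.seq (sumTo 3 7 (.var 2) (.mul (.entry 5 (.var 6) (.var 7)) (.entry 8 (.var 7) (.var 8))))
      (.seq (.setReal 6 (.add (.var 6) (.div (.mul (.var 2) (.var 2))
        (.mul (.entry 9 (.lit 0) (.var 8)) (.entry 9 (.lit 0) (.var 8))))))
      (.setReal 7 (.add (.var 7) (.div (.mul (.var 2) (.var 3))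
        (.entry 9 (.lit 0) (.var 8)))))))))))
    (.setReal 8 (.sub (.div (.var 6) (.sub (.var 5) (.var 4))) (.var 7)))))

/-- Each of the at most `k` singular directions needs two inner products of length `k`, so a column
costs `O(k²)` once `M` is decomposed. Real registers `4` and `5` supply the potentials at `l` and `l
+ 1`. -/
theorem runs_lowerBound {svd : SVDRoutine} {st : Store} {k : ℕ} (hk : 0 < k) (h2 : st.nat 2 = k)
    {M : Matrix (Fin k) (Fin k) ℝ} (hdet : IsUnit M.det) (hsymm : Mᵀ = M) {D : CompactSVD M}
    (hD : HoldsSVD st 8 9 10 10 D) {v : Fin k → ℝ} (hv : ∀ a : Fin k, st.arr 5 (st.nat 6) a = v a) :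
    Runs svd lowerBound st (300 * (k * k)) fun s =>
      s.real 8 = v ⬝ᵥ ((M⁻¹ ^ 2) *ᵥ v) / (st.real 5 - st.real 4) - v ⬝ᵥ (M⁻¹ *ᵥ v) := by
  set p : ℕ → ℝ := fun b => ∑ a ∈ Finset.range k, st.arr 5 (st.nat 6) a * st.arr 10 a b with hp
  set q : ℕ → ℝ := fun b => ∑ a ∈ Finset.range k, st.arr 5 (st.nat 6) a * st.arr 8 a b with hq
  have hcost : 3 + (3 + ((M.rank * ((3 + ((k * (7 + 3 + 1 + 6) + (1 + 4)) + (3 +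
      ((k * (7 + 3 + 1 + 6) + (1 + 4)) + (14 + 10))))) + 1 + 6) + (1 + 4)) + 8)) ≤
      300 * (k * k) := by
    have h1 : M.rank ≤ k := M.rank_le_width
    have h2 : M.rank * k ≤ k * k := Nat.mul_le_mul_right k h1
    have h3 : k ≤ k * k := Nat.le_mul_of_pos_left _ hk
    linarith
  refine Runs.le ?_ hcost
  refine Runs.seq (R := fun s => s.real 6 = 0) (Runs.setReal ?_) fun s₁ hs₁ h6 => ?_
  · simp [Store.setReal_real_self, RealExp.eval, NatExp.eval]
  refine Runs.seq (R := fun s => s.real 7 = 0) (Runs.setReal ?_) fun s₂ hs₂ h7 => ?_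
  · simp [Store.setReal_real_self, RealExp.eval, NatExp.eval]
  refine Runs.seq (runs_forLoop (fun b s =>
    s.real 6 = ∑ c ∈ Finset.range b, p c * p c / (st.arr 9 0 c * st.arr 9 0 c) ∧
    s.real 7 = ∑ c ∈ Finset.range b, p c * q c / st.arr 9 0 c) M.rank rfl ?_ ?_ ?_)
    fun s₃ hs₃ hsum => ?_
  · intro s hs
    exact (hs.nat 10 rfl).trans ((hs₂.nat 10 rfl).trans ((hs₁.nat 10 rfl).trans hD.rank))
  · exact ⟨by simpa [Store.setNat] using (hs₂.real 6 rfl).trans h6,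
      by simpa [Store.setNat] using h7⟩
  · rintro b hb s hs hsb ⟨hi6, hi7⟩
    have hn : ∀ x, x = 2 ∨ x = 6 → s.nat x = st.nat x := by
      rintro x (rfl | rfl) <;> exact (hs.nat _ rfl).trans ((hs₂.nat _ rfl).trans (hs₁.nat _ rfl))
    have ha : ∀ x, s.arr x = st.arr x := fun x =>
      (hs.arr _ rfl).trans ((hs₂.arr _ rfl).trans (hs₁.arr _ rfl))
    refine Runs.seq (R := fun s => s.real 2 = 0) (Runs.setReal ?_) fun t₁ ht₁ e₁ => ?_
    · simp [Store.setReal_real_self, RealExp.eval, NatExp.eval]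
    refine Runs.seq (runs_sumTo (fun a => st.arr 5 (st.nat 6) a * st.arr 10 a b) k ?_ ?_)
      fun t₂ ht₂ e₂ => ?_
    · exact fun t ht => (ht.nat 2 rfl).trans ((ht₁.nat 2 rfl).trans ((hn 2 (.inl rfl)).trans h2))
    · intro a _ t ht hta
      have e6 : t.nat 6 = st.nat 6 := (ht.nat 6 rfl).trans ((ht₁.nat 6 rfl).trans (hn 6 (.inr rfl)))
      have e8 : t.nat 8 = b := (ht.nat 8 rfl).trans ((ht₁.nat 8 rfl).trans hsb)
      have e : ∀ x, t.arr x = st.arr x := fun x =>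
        (ht.arr x rfl).trans ((ht₁.arr x rfl).trans (ha x))
      simp only [RealExp.eval, NatExp.eval, hta, e6, e8, e]
    refine Runs.seq (R := fun s => s.real 3 = 0) (Runs.setReal ?_) fun t₃ ht₃ e₃ => ?_
    · simp [Store.setReal_real_self, RealExp.eval, NatExp.eval]
    refine Runs.seq (runs_sumTo (fun a => st.arr 5 (st.nat 6) a * st.arr 8 a b) k ?_ ?_)
      fun t₄ ht₄ e₄ => ?_
    · exact fun t ht => (ht.nat 2 rfl).trans ((ht₃.nat 2 rfl).trans ((ht₂.nat 2 rfl).trans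
        ((ht₁.nat 2 rfl).trans ((hn 2 (.inl rfl)).trans h2))))
    · intro a _ t ht hta
      have e6 : t.nat 6 = st.nat 6 := (ht.nat 6 rfl).trans ((ht₃.nat 6 rfl).trans
        ((ht₂.nat 6 rfl).trans ((ht₁.nat 6 rfl).trans (hn 6 (.inr rfl)))))
      have e8 : t.nat 8 = b := (ht.nat 8 rfl).trans ((ht₃.nat 8 rfl).trans
        ((ht₂.nat 8 rfl).trans ((ht₁.nat 8 rfl).trans hsb)))
      have e : ∀ x, t.arr x = st.arr x := fun x =>
        (ht.arr x rfl).trans ((ht₃.arr x rfl).trans ((ht₂.arr x rfl).trans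
          ((ht₁.arr x rfl).trans (ha x))))
      simp only [RealExp.eval, NatExp.eval, hta, e6, e8, e]
    have e8 : t₄.nat 8 = b := (ht₄.nat 8 rfl).trans ((ht₃.nat 8 rfl).trans
        ((ht₂.nat 8 rfl).trans ((ht₁.nat 8 rfl).trans hsb)))
    have e : ∀ x, t₄.arr x = st.arr x := fun x =>
      (ht₄.arr x rfl).trans ((ht₃.arr x rfl).trans ((ht₂.arr x rfl).trans
        ((ht₁.arr x rfl).trans (ha x))))
    have er : ∀ x, x = 6 ∨ x = 7 → t₄.real x = s.real x := by
      rintro x (rfl | rfl) <;> exact (ht₄.real _ rfl).trans ((ht₃.real _ rfl).trans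
        ((ht₂.real _ rfl).trans (ht₁.real _ rfl)))
    have f2 : t₄.real 2 = p b := by
      rw [ht₄.real 2 rfl, ht₃.real 2 rfl, e₂, e₁, zero_add]
    have f3 : t₄.real 3 = q b := by rw [e₄, e₃, zero_add]
    refine Runs.seq (R := fun t => t = t₄.setReal 6 (∑ c ∈ Finset.range (b + 1),
      p c * p c / (st.arr 9 0 c * st.arr 9 0 c))) (N := 14) (N' := 10) (Runs.setReal ?_) ?_
    · simp only [RealExp.eval, NatExp.eval, f2, e8, e, er 6 (.inl rfl), hi6, Finset.sum_range_succ]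
    · rintro _ - rfl
      refine Runs.setReal (e := .add (.var 7) (.div (.mul (.var 2) (.var 3))
        (.entry 9 (.lit 0) (.var 8)))) ?_
      have f7 := er 7 (.inr rfl)
      refine ⟨by simp [Store.setReal, Store.setNat], ?_⟩
      simp only [RealExp.eval, NatExp.eval, Store.setReal, Store.setNat, Function.update_self]
      simp only [Function.update_apply, f2, f3, f7, e8, e, hi7, Finset.sum_range_succ]
      simp
  · refine Runs.setReal (e := .sub (.div (.var 6) (.sub (.var 5) (.var 4))) (.var 7)) ?_
    have g5 : s₃.real 5 = st.real 5 :=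
      (hs₃.real 5 rfl).trans ((hs₂.real 5 rfl).trans (hs₁.real 5 rfl))
    have g4 : s₃.real 4 = st.real 4 :=
      (hs₃.real 4 rfl).trans ((hs₂.real 4 rfl).trans (hs₁.real 4 rfl))
    have hp' : ∀ b : Fin M.rank, p b = ∑ a, v a * D.V a b := fun b => by
      simp only [hp, Finset.sum_range, hv, hD.right]
    have hq' : ∀ b : Fin M.rank, q b = ∑ a, v a * D.U a b := fun b => by
      simp only [hq, Finset.sum_range, hv, hD.left]
    rw [Store.setReal_real_self]
    simp only [RealExp.eval, hsum.1, hsum.2, g5, g4]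
    rw [D.dotProduct_inv_sq_mulVec hdet hsymm, D.dotProduct_inv_mulVec hdet, Finset.sum_range,
      Finset.sum_range]
    simp only [hp', hq', hD.sing]

/-- Find a column whose lower bound is positive and at least its upper bound. The column is written
into the natural-number register `9`, its lower bound into the real register `9`. -/
def choose : Cmd :=
  forLoop 6 (.var 1) (.seq lowerBound
    (.ite (.not (.realLt (.var 8) (.mul (.div (.entry 6 (.var 6) (.lit 0)) (.var 1))
        (.sub (.ofNat (.lit 1)) (.sqrt (.div (.ofNat (.var 2)) (.ofNat (.var 3))))))))
      (.ite (.realLt (.ofNat (.lit 0)) (.var 8))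
        (.seq (.setNat 9 (.var 6)) (.setReal 9 (.var 8))) .skip) .skip))

theorem runs_choose {svd : SVDRoutine} {st : Store} {k n : ℕ} (hk : 0 < k) (hn : 0 < n)
    (h1 : st.nat 1 = n) (h2 : st.nat 2 = k) {M : Matrix (Fin k) (Fin k) ℝ} (hdet : IsUnit M.det)
    (hsymm : Mᵀ = M) {D : CompactSVD M} (hD : HoldsSVD st 8 9 10 10 D) {v : Fin n → Fin k → ℝ}
    (hv : ∀ (i : Fin n) (a : Fin k), st.arr 5 i a = v i a) {L U : Fin n → ℝ}
    (hU : ∀ i : Fin n, st.arr 6 i 0 / st.real 1 * (1 - √((st.nat 2 : ℝ) / st.nat 3)) = U i)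
    (hL : ∀ i, v i ⬝ᵥ ((M⁻¹ ^ 2) *ᵥ v i) / (st.real 5 - st.real 4) - v i ⬝ᵥ (M⁻¹ *ᵥ v i) = L i)
    (hex : ∃ i, U i ≤ L i ∧ 0 < L i) :
    Runs svd choose st (400 * (n * (k * k))) fun s =>
      ∃ c : Fin n, s.nat 9 = c ∧ U c ≤ L c ∧ 0 < L c ∧ s.real 9 = L c := by
  have hcost : n * ((300 * (k * k) + (18 + (4 + (2 + 2)))) + 1 + 6) + (1 + 4) ≤
      400 * (n * (k * k)) := by
    have h1 : 1 ≤ k * k := Nat.mul_pos hk hk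
    have h2 : n ≤ n * (k * k) := Nat.le_mul_of_pos_right _ h1
    linarith
  -- The invariant is conditional: once a suitable column has been seen, the registers hold one. A
  -- later suitable column overwrites it, an unsuitable one changes nothing.
  refine Runs.mono (runs_forLoop (fun j s => (∃ i : Fin n, (i : ℕ) < j ∧ U i ≤ L i ∧ 0 < L i) →
    ∃ c : Fin n, s.nat 9 = c ∧ U c ≤ L c ∧ 0 < L c ∧ s.real 9 = L c) n rfl
    (fun s hs => (hs.nat 1 rfl).trans h1) ?_ ?_) hcost fun s _ hs => ?_
  · rintro ⟨i, hi, -⟩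
    exact absurd hi (Nat.not_lt_zero _)
  · intro j hj s hs hsj hinv
    have g : ∀ x, x = 2 ∨ x = 3 → s.nat x = st.nat x := by
      rintro x (rfl | rfl) <;> exact hs.nat _ rfl
    refine Runs.seq (runs_lowerBound hk ((hs.nat 2 rfl).trans h2) hdet hsymm
      (hD.congr (hs.arr 8 rfl) (hs.arr 9 rfl) (hs.arr 10 rfl) (hs.nat 10 rfl)) (v := v ⟨j, hj⟩)
      fun a => by rw [hs.arr 5 rfl, hsj]; exact hv ⟨j, hj⟩ a) fun s₁ hs₁ h8 => ?_
    rw [hs.real 5 rfl, hs.real 4 rfl, hL] at h8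
    have hU' : (RealExp.mul (.div (.entry 6 (.var 6) (.lit 0)) (.var 1))
        (.sub (.ofNat (.lit 1)) (.sqrt (.div (.ofNat (.var 2)) (.ofNat (.var 3)))))).eval s₁ =
        U ⟨j, hj⟩ := by
      rw [← hU]
      simp only [RealExp.eval, NatExp.eval, hs₁.nat 6 rfl, hs₁.nat 2 rfl, hs₁.nat 3 rfl,
        hs.nat 2 rfl, hs.nat 3 rfl, hsj, hs₁.arr 6 rfl, hs.arr 6 rfl, hs₁.real 1 rfl,
        hs.real 1 rfl, Nat.cast_one]
    have h0 : (RealExp.ofNat (.lit 0)).eval s₁ = 0 := by simp [RealExp.eval, NatExp.eval]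
    have h8' : (RealExp.var 8).eval s₁ = L ⟨j, hj⟩ := h8
    have hskip : ¬ (U ⟨j, hj⟩ ≤ L ⟨j, hj⟩ ∧ 0 < L ⟨j, hj⟩) →
        (∃ i : Fin n, (i : ℕ) < j + 1 ∧ U i ≤ L i ∧ 0 < L i) →
        ∃ c : Fin n, (s₁.setNat 6 (j + 1)).nat 9 = c ∧ U c ≤ L c ∧ 0 < L c ∧
          (s₁.setNat 6 (j + 1)).real 9 = L c := by
      rintro hbad ⟨i, hi, hi'⟩
      have hij : (i : ℕ) ≠ j := by
        rintro rfl
        exact hbad hi'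
      obtain ⟨c, hc9, hc⟩ := hinv ⟨i, by omega, hi'⟩
      refine ⟨c, ?_, hc.1, hc.2.1, ?_⟩
      · rw [← hc9, ← hs₁.nat 9 rfl]; simp [Store.setNat]
      · rw [← hc.2.2, ← hs₁.real 9 rfl]; rfl
    refine Runs.ite (N := 4 + (2 + 2)) (fun hle => ?_) fun hlt =>
      (Runs.skip ?_).le (by norm_num)
    · simp only [Test.Holds, hU', h8', not_lt] at hle
      refine Runs.ite (N := 2 + 2) (fun hpos => ?_) fun hpos => (Runs.skip ?_).le (by norm_num)
      · simp only [Test.Holds, h0, h8'] at hpos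
        refine Runs.seq (R := fun t => t = s₁.setNat 9 j) (N := 2) (N' := 2) (Runs.setNat ?_) ?_
        · simp only [NatExp.eval, hs₁.nat 6 rfl, hsj]
        · rintro _ - rfl
          refine Runs.setReal (e := .var 8) fun _ => ⟨⟨j, hj⟩, ?_, hle, hpos, ?_⟩
          · simp [Store.setNat, Store.setReal]
          · simpa [Store.setNat, Store.setReal, RealExp.eval] using h8
      · simp only [Test.Holds, h0, h8'] at hpos
        exact hskip fun h => hpos h.2
    · simp only [Test.Holds, hU', h8', not_not] at hlt
      exact hskip fun h => absurd hlt (not_lt.mpr h.1)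
  · obtain ⟨i, hi⟩ := hex
    exact hs ⟨i, i.2, hi⟩

/-- Add the chosen column with the weight given by its lower bound. -/
def update : Cmd :=
  .seq (fillArr 7 7 8 (.var 2) (.var 2) (.add (.entry 7 (.var 7) (.var 8))
    (.div (.mul (.entry 5 (.var 9) (.var 7)) (.entry 5 (.var 9) (.var 8))) (.var 9))))
  (.setEntry 11 (.var 9) (.lit 0) (.add (.entry 11 (.var 9) (.lit 0)) (.var 9)))

/-- Real register `9` holds `L = 1/t`: the rank-one term is divided by it, and array `11` gains it
as the squared entry of `S`. -/
theorem runs_update {svd : SVDRoutine} {st : Store} {k n : ℕ} (hk : 0 < k) (h2 : st.nat 2 = k)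
    {c : Fin n} (h9 : st.nat 9 = c) {v : Fin k → ℝ} (hv : ∀ a : Fin k, st.arr 5 c a = v a) :
    Runs svd update st (100 * (k * k)) fun s =>
      readBlock (s.arr 7) k k = readBlock (st.arr 7) k k + (1 / st.real 9) • vecMulVec v v ∧
      ∀ a : Fin n, s.arr 11 a 0 = st.arr 11 a 0 + if a = c then st.real 9 else 0 := by
  have hcost : (k * ((k * (13 + 3 + 1 + 6) + (1 + 4)) + 1 + 6) + (1 + 4)) + 8 ≤
      100 * (k * k) := by
    have h1 : k ≤ k * k := Nat.le_mul_of_pos_left _ hk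
    linarith
  refine Runs.le ?_ hcost
  refine Runs.seq (runs_fillArr (fun a b => st.arr 7 a b + st.arr 5 c a * st.arr 5 c b / st.real 9)
    k k (by decide) (fun s hs => (hs.nat 2 rfl).trans h2) (fun s hs => (hs.nat 2 rfl).trans h2)
    fun a _ b _ s hs ha hb hab => ?_) fun s hs h7 => ?_
  · simp only [RealExp.eval, NatExp.eval, ha, hb, hab, hs.nat 9 rfl, h9, hs.arr 5 rfl,
      hs.real 9 rfl]
  · refine Runs.setEntry (i := .var 9) (j := .lit 0)
      (e := .add (.entry 11 (.var 9) (.lit 0)) (.var 9)) ⟨?_, fun a => ?_⟩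
    · ext a b
      simp only [readBlock, of_apply, Matrix.add_apply, Matrix.smul_apply, vecMulVec_apply,
        smul_eq_mul]
      rw [Store.setEntry_arr_of_ne _ (by decide), h7 a a.2 b b.2, hv, hv]
      ring
    · rw [Store.setEntry_arr]
      simp only [RealExp.eval, NatExp.eval, hs.nat 9 rfl, h9, hs.arr 11 rfl, hs.real 9 rfl,
        and_true, Fin.val_inj]
      split_ifs with h
      · rw [h]
      · rw [add_zero]

/-- One step of the sampling procedure. -/
def samplingStep : Cmd :=
  .seq (invTrace 4) (.seq (diagShift (.sub (.ofNat (.lit 0)) (.ofNat (.lit 1))))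
    (.seq (invTrace 5) (.seq choose update)))

/-- The parts of the memory that the sampling procedure reads. -/
structure HoldsColumns (s : Store) {k m n : ℕ} (Vt : Matrix (Fin k) (Fin n) ℝ)
    (E : Matrix (Fin m) (Fin n) ℝ) (r : ℕ) : Prop where
  n_eq : s.nat 1 = n
  k_eq : s.nat 2 = k
  r_eq : s.nat 3 = r
  cols : ∀ (i : Fin n) (a : Fin k), s.arr 5 i a = Vt.col i a
  norms : ∀ i : Fin n, s.arr 6 i 0 = E.col i ⬝ᵥ E.col i
  frob : s.real 1 = frobNorm E ^ 2

theorem HoldsColumns.congr {s s' : Store} {k m n : ℕ} {Vt : Matrix (Fin k) (Fin n) ℝ}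
    {E : Matrix (Fin m) (Fin n) ℝ} {r : ℕ} (h : HoldsColumns s Vt E r) {c : Cmd}
    (hc : Same c s s') (h1 : c.writesNat 1 = false) (h2 : c.writesNat 2 = false)
    (h3 : c.writesNat 3 = false) (h5 : c.writesArr 5 = false) (h6 : c.writesArr 6 = false)
    (hr : c.writesReal 1 = false) : HoldsColumns s' Vt E r :=
  ⟨(hc.nat 1 h1).trans h.n_eq, (hc.nat 2 h2).trans h.k_eq, (hc.nat 3 h3).trans h.r_eq,
    by rw [hc.arr 5 h5]; exact h.cols, by rw [hc.arr 6 h6]; exact h.norms,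
    (hc.real 1 hr).trans h.frob⟩

theorem runs_samplingStep {svd : SVDRoutine} {st : Store} {k m n r τ : ℕ} (hk : 0 < k)
    (hkn : k ≤ n) (hkr : k < r) {Vt : Matrix (Fin k) (Fin n) ℝ} (hV : Vt * Vtᵀ = 1)
    {E : Matrix (Fin m) (Fin n) ℝ} (hE : frobNorm E ≠ 0) (hst : HoldsColumns st Vt E r)
    {B : Matrix (Fin k) (Fin k) ℝ} (hB : BarrierInvariant r τ B)
    (hM : readBlock (st.arr 7) k k = B - barrier k r τ • 1) :
    Runs svd samplingStep st (1000 * (n * (k * k))) fun s => ∃ (c : Fin n) (t : ℝ),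
      Admissible Vt E r B τ c t ∧
      readBlock (s.arr 7) k k =
        B + t • vecMulVec (Vt.col c) (Vt.col c) - barrier k r (τ + 1) • 1 ∧
      ∀ a : Fin n, s.arr 11 a 0 = st.arr 11 a 0 + if a = c then 1 / t else 0 := by
  have hn : 0 < n := hk.trans_le hkn
  -- The two decompositions cost `O(k³)`, which `k ≤ n` absorbs into the `O(n k²)` scan of the
  -- columns.
  have hcost : 100 * (k * k * k) + ((k * (5 + 14) + 5) + (100 * (k * k * k) +
      (400 * (n * (k * k)) + 100 * (k * k)))) ≤ 1000 * (n * (k * k)) := by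
    have h1 : k ≤ k * k := Nat.le_mul_of_pos_left _ hk
    have h2 : k * k ≤ n * (k * k) := Nat.le_mul_of_pos_left _ hn
    have h3 : k * k * k ≤ n * (k * k) := by
      rw [mul_comm n]; exact Nat.mul_le_mul_left _ hkn
    linarith
  have hlt := hB.2.trans_lt (sqrt_div_lt_one hkr)
  have hpd := hB.1
  have hpd' := posDef_sub_succ hpd hlt
  refine Runs.le ?_ hcost
  refine Runs.seq (runs_invTrace hk hst.k_eq hM ((isUnit_iff_isUnit_det _).mp hpd.isUnit))
    fun s₁ hs₁ ⟨_, h4⟩ => ?_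
  rw [← phi_eq_trace_inv hpd] at h4
  have hst₁ := hst.congr hs₁ rfl rfl rfl rfl rfl rfl
  -- Subtracting the identity turns `B - l_τ` into `B - l_{τ+1}`, the matrix that enters `L` and,
  -- after the rank-one update, the next step.
  refine Runs.seq (runs_diagShift hst₁.k_eq (c := -1) fun s _ => ?_) fun s₂ hs₂ h7 => ?_
  · simp [RealExp.eval, NatExp.eval]
  have hM₂ : readBlock (s₂.arr 7) k k = B - (barrier k r τ + 1) • 1 := by
    rw [h7, hs₁.arr 7 rfl, hM, add_smul, neg_smul, one_smul]
    abel
  have hst₂ := hst₁.congr hs₂ rfl rfl rfl rfl rfl rfl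
  have hdet := (isUnit_iff_isUnit_det _).mp hpd'.isUnit
  refine Runs.seq (runs_invTrace hk hst₂.k_eq hM₂ hdet) fun s₃ hs₃ ⟨hD, h5⟩ => ?_
  rw [← phi_eq_trace_inv hpd'] at h5
  have hst₃ := hst₂.congr hs₃ rfl rfl rfl rfl rfl rfl
  have h4' : s₃.real 4 = phi (barrier k r τ) B := by rw [hs₃.real 4 rfl, hs₂.real 4 rfl, h4]
  refine Runs.seq (runs_choose hk hn hst₃.n_eq hst₃.k_eq hdet (by simpa [IsHermitian] using hpd'.1)
    hD hst₃.cols (U := fun i => upperU E k r (E.col i))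
    (L := fun i => lowerL (Vt.col i) B (barrier k r τ)) (fun i => ?_) (fun i => ?_)
    (hB.exists_le hk hkr hV hE)) fun s₄ hs₄ ⟨c, h9, hUL, hL, hr9⟩ => ?_
  · rw [hst₃.norms, hst₃.frob, hst₃.k_eq, hst₃.r_eq, upperU]
  · rw [h4', h5, lowerL]
  have hst₄ := hst₃.congr hs₄ rfl rfl rfl rfl rfl rfl
  refine (runs_update hk hst₄.k_eq h9 (hst₄.cols c)).imp fun s hs ⟨h7', h11⟩ =>
    ⟨c, 1 / lowerL (Vt.col c) B (barrier k r τ), ⟨by positivity, by simpa using hUL, by simp⟩,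
      ?_, fun a => ?_⟩
  · rw [h7', hs₄.arr 7 rfl, hs₃.arr 7 rfl, hM₂, hr9, barrier_succ]
    abel
  · rw [h11, hr9, hs₄.arr 11 rfl, hs₃.arr 11 rfl, hs₂.arr 11 rfl, hs₁.arr 11 rfl, one_div_one_div]

/-- All steps of the sampling procedure. -/
def samplingLoop : Cmd := forLoop 5 (.var 3) samplingStep

theorem runs_samplingLoop {svd : SVDRoutine} {st : Store} {k m n r : ℕ} (hk : 0 < k)
    (hkn : k ≤ n) (hkr : k < r) {Vt : Matrix (Fin k) (Fin n) ℝ} (hV : Vt * Vtᵀ = 1)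
    {E : Matrix (Fin m) (Fin n) ℝ} (hE : frobNorm E ≠ 0) (hst : HoldsColumns st Vt E r)
    (hM : readBlock (st.arr 7) k k = √((r : ℝ) * k) • 1) (h11 : ∀ a, st.arr 11 a 0 = 0) :
    Runs svd samplingLoop st (1100 * (r * (n * (k * k)))) fun s => ∃ (i : ℕ → Fin n) (t : ℕ → ℝ),
      SamplingSteps Vt E r r i t ∧
      ∀ a : Fin n, s.arr 11 a 0 = ∑ τ ∈ Finset.range r, if a = i τ then 1 / t τ else 0 := by
  have hn : 0 < n := hk.trans_le hkn
  have hcost : r * (1000 * (n * (k * k)) + 1 + 6) + (1 + 4) ≤ 1100 * (r * (n * (k * k))) := by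
    have h1 : 1 ≤ n * (k * k) := Nat.mul_pos hn (Nat.mul_pos hk hk)
    have h2 : r ≤ r * (n * (k * k)) := Nat.le_mul_of_pos_right _ h1
    have h3 : 0 < r := hk.trans hkr
    linarith
  refine (runs_forLoop (e := .var 3) (fun τ s => ∃ (i : ℕ → Fin n) (t : ℕ → ℝ), SamplingSteps Vt E r τ i t ∧
    (∀ a : Fin n, s.arr 11 a 0 = ∑ τ' ∈ Finset.range τ, if a = i τ' then 1 / t τ' else 0) ∧
    readBlock (s.arr 7) k k = accum Vt i t τ - barrier k r τ • 1) r rfl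
    (fun s hs => (hs.nat 3 rfl).trans hst.r_eq) ?_ ?_).mono hcost
    fun s _ ⟨i, t, h, h', _⟩ => ⟨i, t, h, h'⟩
  · refine ⟨fun _ => ⟨0, hn⟩, fun _ => 0, fun _ h => absurd h (Nat.not_lt_zero _),
      fun a => by simpa [Store.setNat] using h11 a, ?_⟩
    rw [Store.setNat_arr, hM]
    simp [accum, barrier]
  · rintro τ - s hs - ⟨i, t, h, hd, hB⟩
    refine (runs_samplingStep hk hkn hkr hV hE (hst.congr hs rfl rfl rfl rfl rfl rfl)
      (h.barrierInvariant hk hkr) hB).imp fun s' hs' ⟨c, t', hadm, hB', hd'⟩ =>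
      ⟨_, _, h.update hadm, fun a => ?_, ?_⟩
    · rw [Store.setNat_arr, hd', hd, Finset.sum_range_succ, Function.update_self,
        Function.update_self]
      congr 1
      refine Finset.sum_congr rfl fun τ' hτ' => ?_
      have := (Finset.mem_range.mp hτ').ne
      rw [Function.update_of_ne this, Function.update_of_ne this]
    · rw [Store.setNat_arr, hB', accum, accum_update Vt i t le_rfl, Function.update_self,
        Function.update_self]

/-! ### Preprocessing, the final solve and the whole program -/

/-- Count up to the number of columns to be sampled. -/
def countCols : Cmd :=
  .while (.realLt (.mul (.mul (.ofNat (.var 3)) (.var 0)) (.var 0))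
    (.mul (.ofNat (.lit 9)) (.ofNat (.var 2)))) (.setNat 3 (.add (.var 3) (.lit 1)))

/-- The machine has no ceiling operation, but `i ε² < 9k` holds exactly for `i < ⌈9k/ε²⌉`. Counting
up costs `O(r)`, less than the sampling itself. -/
theorem runs_countCols {svd : SVDRoutine} {st : Store} {k : ℕ} {ε : ℝ} (hε : 0 < ε)
    (h2 : st.nat 2 = k) (h3 : st.nat 3 = 0) (hr0 : st.real 0 = ε) :
    Runs svd countCols st (numCols k ε * 16 + 12) fun s => s.nat 3 = numCols k ε := by
  have key : ∀ i : ℕ, (i : ℝ) * ε * ε < ((9 : ℕ) : ℝ) * k ↔ i < numCols k ε := fun i => by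
    rw [numCols, Nat.lt_ceil, lt_div_iff₀ (by positivity), sq, mul_assoc]
    norm_num
  have htest : ∀ s, Same (.setNat 3 (.add (.var 3) (.lit 1))) st s → ∀ i, s.nat 3 = i →
      ((Test.realLt (.mul (.mul (.ofNat (.var 3)) (.var 0)) (.var 0))
        (.mul (.ofNat (.lit 9)) (.ofNat (.var 2)))).Holds s ↔ i < numCols k ε) :=
    fun s hs i hi => by
      simp only [Test.Holds, RealExp.eval, NatExp.eval, hi, hs.real 0 rfl, hr0, hs.nat 2 rfl, h2]
      exact key i
  refine (Runs.while_count (C := 4) (fun i s => s.nat 3 = i) (numCols k ε) (fun i hi s hs hinv =>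
    ⟨(htest s hs i hinv).mpr hi, Runs.setNat ?_⟩) (fun s hs hinv => ?_) h3).le le_rfl
  · simp [Store.setNat, NatExp.eval, hinv]
  · rw [htest s hs _ hinv]
    exact lt_irrefl _

/-- Decompose `A` and compute the column norms of the residual. -/
def prepare : Cmd :=
  .seq (.svd (.var 0) (.var 1) 0 3 4 5 4)
    (.seq (fillCol 6 6 (.var 1) 2 7 (.sub (.var 4) (.var 2))
      (.mul (.mul (.entry 4 (.lit 0) (.add (.var 2) (.var 7)))
          (.entry 5 (.var 6) (.add (.var 2) (.var 7))))
        (.mul (.entry 4 (.lit 0) (.add (.var 2) (.var 7)))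
          (.entry 5 (.var 6) (.add (.var 2) (.var 7))))) (.var 2))
    (.seq (sumTo 1 6 (.var 1) (.entry 6 (.var 6) (.lit 0)))
      (diagShift (.sqrt (.mul (.ofNat (.var 3)) (.ofNat (.var 2)))))))

/-- Matches the masked sum for the residual norms with the loop of the program, which starts at
offset `k`. -/
theorem sum_ite_lt_eq (k ρ : ℕ) (hk : k ≤ ρ) (g : ℕ → ℝ) :
    ∑ j : Fin ρ, (if (j : ℕ) < k then 0 else g j) = ∑ j ∈ Finset.range (ρ - k), g (k + j) := by
  rw [← Finset.sum_range fun j => if j < k then 0 else g j]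
  obtain ⟨l, rfl⟩ := Nat.exists_eq_add_of_le hk
  rw [Finset.sum_range_add, Nat.add_sub_cancel_left,
    Finset.sum_eq_zero fun j hj => if_pos (Finset.mem_range.mp hj), zero_add]
  simp

theorem runs_prepare {svd : SVDRoutine} {st : Store} {m n k r : ℕ} {A : Matrix (Fin m) (Fin n) ℝ}
    (hk₀ : 0 < k) (hk : k < A.rank) (h0 : st.nat 0 = m) (h1 : st.nat 1 = n) (h2 : st.nat 2 = k)
    (h3 : st.nat 3 = r) (hA : readBlock (st.arr 0) m n = A) (hr1 : st.real 1 = 0)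
    (h7 : ∀ i j, st.arr 7 i j = 0) :
    Runs svd prepare st (100 * (m * n * min m n)) fun s =>
      HoldsColumns s ((svd m n A).Vk hk.le)ᵀ (residualMatrix (svd m n A) hk.le) r ∧
      readBlock (s.arr 7) k k = √((r : ℝ) * k) • 1 := by
  have hρm : A.rank ≤ m := A.rank_le_height
  have hρn : A.rank ≤ n := A.rank_le_width
  have hcost : m * n * min m n + 3 + ((n * (((A.rank - k) * (23 + 3 + 3 + 6) + (3 + 1 + 10)) +
      1 + 6) + (1 + 4)) + ((n * (3 + 3 + 1 + 6) + (1 + 4)) + (k * (6 + 14) + 5))) ≤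
      100 * (m * n * min m n) := by
    have hmin : A.rank ≤ min m n := le_min hρm hρn
    generalize min m n = l at *
    have e1 : n * (A.rank - k) ≤ n * l := Nat.mul_le_mul_left _ (by omega)
    have e2 : n * l ≤ m * (n * l) := Nat.le_mul_of_pos_left _ (by omega)
    have e3 : n ≤ n * l := Nat.le_mul_of_pos_right _ (by omega)
    rw [mul_assoc]
    have e4 : 1 ≤ n := by omega
    have e5 : k ≤ n := by omega
    nlinarith
  refine Runs.le ?_ hcost
  set D := svd m n A
  refine Runs.seq (runs_svd (by decide) (by decide) (by decide) h0 h1 hA) fun s₁ hs₁ hD => ?_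
  have g1 : s₁.nat 1 = n := (hs₁.nat 1 rfl).trans h1
  have g2 : s₁.nat 2 = k := (hs₁.nat 2 rfl).trans h2
  refine Runs.seq (runs_fillCol (fun i j => (s₁.arr 4 0 (k + j) * s₁.arr 5 i (k + j)) *
    (s₁.arr 4 0 (k + j) * s₁.arr 5 i (k + j))) (fun _ x => x) n (A.rank - k) (by decide)
    (fun s hs => (hs.nat 1 rfl).trans g1) (fun s hs => ?_) (fun i _ j _ s hs hi hj => ?_)
    fun i _ s hs _ => rfl) fun s₂ hs₂ h6 => ?_
  · simp only [NatExp.eval, hs.nat 4 rfl, hs.nat 2 rfl, hD.rank, g2]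
  · simp only [RealExp.eval, NatExp.eval, hi, hj, hs.arr 4 rfl, hs.arr 5 rfl, hs.nat 2 rfl, g2]
  have hnorm : ∀ i : Fin n, s₂.arr 6 i 0 =
      (residualMatrix D hk.le).col i ⬝ᵥ (residualMatrix D hk.le).col i := fun i => by
    rw [h6 i i.2, D.col_residualMatrix_dotProduct, ← sum_ite_lt_eq k A.rank hk.le fun j =>
      (s₁.arr 4 0 j * s₁.arr 5 i j) * (s₁.arr 4 0 j * s₁.arr 5 i j)]
    refine Finset.sum_congr rfl fun j _ => ?_
    rw [hD.sing, hD.right, sq]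
  refine Runs.seq (runs_sumTo (fun i => s₂.arr 6 i 0) n
    (fun s hs => (hs.nat 1 rfl).trans ((hs₂.nat 1 rfl).trans g1)) fun i _ s hs hi => ?_)
    fun s₃ hs₃ hr => ?_
  · simp only [RealExp.eval, NatExp.eval, hi, hs.arr 6 rfl]
  have g2' : s₃.nat 2 = k := (hs₃.nat 2 rfl).trans ((hs₂.nat 2 rfl).trans g2)
  have g3' : s₃.nat 3 = r := (hs₃.nat 3 rfl).trans ((hs₂.nat 3 rfl).trans ((hs₁.nat 3 rfl).trans h3))
  refine (runs_diagShift g2' (c := √((r : ℝ) * k)) fun s hs => ?_).imp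
    fun s hs hM => ⟨⟨?_, ?_, ?_, ?_, ?_, ?_⟩, ?_⟩
  · simp only [RealExp.eval, NatExp.eval, hs.nat 3 rfl, hs.nat 2 rfl, g3', g2']
  · exact (hs.nat 1 rfl).trans ((hs₃.nat 1 rfl).trans ((hs₂.nat 1 rfl).trans g1))
  · exact (hs.nat 2 rfl).trans g2'
  · exact (hs.nat 3 rfl).trans g3'
  · intro i a
    rw [hs.arr 5 rfl, hs₃.arr 5 rfl, hs₂.arr 5 rfl]
    exact hD.right i (Fin.castLE hk.le a)
  · intro i
    rw [hs.arr 6 rfl, hs₃.arr 6 rfl, hnorm]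
  · rw [hs.real 1 rfl, hr, hs₂.real 1 rfl, hs₁.real 1 rfl, hr1, zero_add, Finset.sum_range,
      frobNorm_sq]
    exact Finset.sum_congr rfl fun i _ => hnorm i
  -- As `B_0 = 0` and `l_0 = -√(rk)`, shifting the zero array by `√(rk)` yields `B_0 - l_0`.
  · rw [hM, hs₃.arr 7 rfl, hs₂.arr 7 rfl, hs₁.arr 7 rfl]
    have : readBlock (st.arr 7) k k = 0 := by ext i j; simp [readBlock, h7]
    rw [this, zero_add]

/-- Solve the regression problem for the reweighted columns. -/
def solve : Cmd :=
  .seq (fillArr 12 6 7 (.var 0) (.var 1)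
    (.mul (.entry 0 (.var 6) (.var 7)) (.sqrt (.entry 11 (.var 7) (.lit 0)))))
  (.seq (.svd (.var 0) (.var 1) 12 8 9 10 10)
  (.seq (fillCol 13 8 (.var 10) 2 6 (.var 0)
    (.mul (.entry 8 (.var 6) (.var 8)) (.entry 1 (.var 6) (.lit 0)))
    (.div (.var 2) (.entry 9 (.lit 0) (.var 8))))
  (fillCol 2 7 (.var 1) 2 8 (.var 10)
    (.mul (.entry 10 (.var 7) (.var 8)) (.entry 13 (.var 8) (.lit 0)))
    (.mul (.sqrt (.entry 11 (.var 7) (.lit 0))) (.var 2)))))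

theorem runs_solve {svd : SVDRoutine} {st : Store} {m n : ℕ} {A : Matrix (Fin m) (Fin n) ℝ}
    {b : Fin m → ℝ} (hm : 0 < m) (hn : 0 < n) (h0 : st.nat 0 = m) (h1 : st.nat 1 = n)
    (hA : ∀ (i : Fin m) (j : Fin n), st.arr 0 i j = A i j) (hb : ∀ i : Fin m, st.arr 1 i 0 = b i)
    {d : Fin n → ℝ} (hd : ∀ j : Fin n, st.arr 11 j 0 = d j) :
    Runs svd solve st (200 * (m * n * min m n)) fun s => outputVector s n =
      (diagonal (fun j => √(d j)) * pinv (A * diagonal fun j => √(d j))) *ᵥ b := by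
  set F := A * diagonal fun j => √(d j) with hF
  have hcost : (m * ((n * (8 + 3 + 1 + 6) + (1 + 4)) + 1 + 6) + (1 + 4)) + (m * n * min m n + 3 +
      ((F.rank * ((m * (7 + 3 + 1 + 6) + (1 + 5 + 10)) + 1 + 6) + (1 + 4)) +
        (n * ((F.rank * (7 + 3 + 1 + 6) + (1 + 6 + 10)) + 1 + 6) + (1 + 4)))) ≤
      200 * (m * n * min m n) := by
    have hmin : F.rank ≤ min m n := le_min F.rank_le_height F.rank_le_width
    have hl : 1 ≤ min m n := le_min hm hn
    generalize min m n = l at *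
    generalize F.rank = ρ at *
    have e0 : m * n ≤ m * n * l := Nat.le_mul_of_pos_right _ hl
    have e1 : ρ * m ≤ m * n * l := by
      calc ρ * m ≤ l * (m * n) := Nat.mul_le_mul hmin (Nat.le_mul_of_pos_right _ hn)
        _ = _ := mul_comm _ _
    have e2 : n * ρ ≤ m * n * l := Nat.mul_le_mul (Nat.le_mul_of_pos_left _ hm) hmin
    have e3 : m ≤ m * n := Nat.le_mul_of_pos_right _ hn
    have e4 : n ≤ m * n := Nat.le_mul_of_pos_left _ hm
    have e5 : ρ ≤ ρ * m := Nat.le_mul_of_pos_right _ hm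
    have e6 : 1 ≤ m * n * l := Nat.mul_pos (Nat.mul_pos hm hn) hl
    linarith
  refine Runs.le ?_ hcost
  refine Runs.seq (runs_fillArr (fun i j => st.arr 0 i j * √(st.arr 11 j 0)) m n (by decide)
    (fun s hs => (hs.nat 0 rfl).trans h0) (fun s hs => (hs.nat 1 rfl).trans h1)
    fun i _ j _ s hs hi hj _ => ?_) fun s₁ hs₁ h12 => ?_
  · simp only [RealExp.eval, NatExp.eval, hi, hj, hs.arr 0 rfl, hs.arr 11 rfl]
  have hFM : readBlock (s₁.arr 12) m n = F := by
    ext i j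
    rw [hF, mul_diagonal, readBlock, of_apply, h12 i i.2 j j.2, hA, hd]
  refine Runs.seq (runs_svd (by decide) (by decide) (by decide) ((hs₁.nat 0 rfl).trans h0)
    ((hs₁.nat 1 rfl).trans h1) hFM) fun s₂ hs₂ hD => ?_
  set D := svd m n F
  refine Runs.seq (runs_fillCol (fun b i => s₂.arr 8 i b * st.arr 1 i 0)
    (fun b x => x / s₂.arr 9 0 b) F.rank m (by decide)
    (fun s hs => (hs.nat 10 rfl).trans hD.rank) (fun s hs => (hs.nat 0 rfl).trans
      ((hs₂.nat 0 rfl).trans ((hs₁.nat 0 rfl).trans h0))) (fun b _ i _ s hs hb hi => ?_)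
    fun b _ s hs hb => ?_) fun s₃ hs₃ h13 => ?_
  · simp only [RealExp.eval, NatExp.eval, hi, hb, hs.arr 8 rfl, hs.arr 1 rfl, hs₂.arr 1 rfl,
      hs₁.arr 1 rfl]
  · simp only [RealExp.eval, NatExp.eval, hb, hs.arr 9 rfl]
  have e10 : s₃.arr 10 = s₂.arr 10 := hs₃.arr 10 rfl
  have e11 : s₃.arr 11 = st.arr 11 := by rw [hs₃.arr 11 rfl, hs₂.arr 11 rfl, hs₁.arr 11 rfl]
  refine (runs_fillCol (e := .var 1) (e' := .var 10) (fun j b => s₂.arr 10 j b * s₃.arr 13 b 0)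
    (fun j x => √(st.arr 11 j 0) * x) n F.rank (by decide)
    (fun s hs => (hs.nat 1 rfl).trans ((hs₃.nat 1 rfl).trans ((hs₂.nat 1 rfl).trans
      ((hs₁.nat 1 rfl).trans h1)))) (fun s hs => (hs.nat 10 rfl).trans
      ((hs₃.nat 10 rfl).trans hD.rank)) (fun j _ b _ s hs hj hb => ?_)
    fun j _ s hs hj => ?_).imp fun s hs hx => ?_
  · simp only [RealExp.eval, NatExp.eval, hj, hb, hs.arr 10 rfl, hs.arr 13 rfl, e10]
  · simp only [RealExp.eval, NatExp.eval, hj, hs.arr 11 rfl, e11]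
  · ext j
    -- `pinv` is defined by a choice of decomposition; `pinv_eq` replaces it by the one the routine
    -- returned.
    rw [outputVector, hx j j.2, ← mulVec_mulVec, mulVec_diagonal, hd, pinv_eq D, CompactSVD.pinv,
      ← mulVec_mulVec, ← mulVec_mulVec, Finset.sum_range]
    congr 1
    refine Finset.sum_congr rfl fun b' _ => ?_
    rw [h13 b' b'.2, hD.right, hD.sing, Finset.sum_range, mulVec_diagonal, mulVec, dotProduct]
    simp only [hD.left, hb, transpose_apply]
    ring

/-- The sparse regression program. -/
def sparseRegression : Cmd :=
  .seq countCols (.seq prepare (.seq samplingLoop solve))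

theorem runs_sparseRegression (svd : SVDRoutine) {m n k : ℕ} (A : Matrix (Fin m) (Fin n) ℝ)
    (b : Fin m → ℝ) {ε : ℝ} (hk₀ : 0 < k) (hk : k < A.rank) (hε : 0 < ε) (hε' : ε < 1 / 2) :
    Runs svd sparseRegression (inputStore A b k ε)
      (300 * (m * n * min m n) + 1200 * (numCols k ε * (n * (k * k)))) fun s =>
      IsSparseRegressionOutput (svd m n A) b hk.le ε (outputVector s n) := by
  have hρm : A.rank ≤ m := A.rank_le_height
  have hρn : A.rank ≤ n := A.rank_le_width
  obtain ⟨hkr, -⟩ := numCols_bound hk₀ hε hε'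
  have hE := (svd m n A).frobNorm_residualMatrix_ne_zero hk.le hk
  have hV : ((svd m n A).Vk hk.le)ᵀ * ((svd m n A).Vk hk.le)ᵀᵀ = 1 := by
    rw [transpose_transpose, CompactSVD.Vk_orth]
  set r := numCols k ε with hr
  have hcost : r * 16 + 12 + (100 * (m * n * min m n) + (1100 * (r * (n * (k * k))) +
      200 * (m * n * min m n))) ≤ 300 * (m * n * min m n) + 1200 * (r * (n * (k * k))) := by
    have h1 : 1 ≤ n * (k * k) := Nat.mul_pos (by omega) (Nat.mul_pos hk₀ hk₀)
    have h2 : r ≤ r * (n * (k * k)) := Nat.le_mul_of_pos_right _ h1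
    have h3 : 0 < r := hk₀.trans hkr
    linarith
  refine Runs.le ?_ hcost
  have hA₀ : ∀ (i : Fin m) (j : Fin n), (inputStore A b k ε).arr 0 i j = A i j := by
    simp [inputStore, Store.setBlock, Store.setReal, Store.setNat, writeBlock]
  have hb₀ : ∀ i : Fin m, (inputStore A b k ε).arr 1 i 0 = b i := by
    simp [inputStore, Store.setBlock, Store.setReal, Store.setNat, writeBlock]
  have hz : ∀ a i j, 1 < a → (inputStore A b k ε).arr a i j = 0 := by
    intro a i j ha
    have h0 : a ≠ 0 := by omega
    have h1 : a ≠ 1 := by omega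
    simp [inputStore, Store.setBlock, Store.setReal, Store.setNat, h0, h1]
  refine Runs.seq (runs_countCols hε (by simp [inputStore, Store.setBlock, Store.setReal,
      Store.setNat]) (by simp [inputStore, Store.setBlock, Store.setReal, Store.setNat])
      (by simp [inputStore, Store.setBlock, Store.setReal, Store.setNat])) fun s₁ hs₁ h3 => ?_
  have g0 : s₁.nat 0 = m := (hs₁.nat 0 rfl).trans (by
    simp [inputStore, Store.setBlock, Store.setReal, Store.setNat])
  have g1 : s₁.nat 1 = n := (hs₁.nat 1 rfl).trans (by
    simp [inputStore, Store.setBlock, Store.setReal, Store.setNat])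
  refine Runs.seq (runs_prepare (A := A) hk₀ hk g0 g1 ((hs₁.nat 2 rfl).trans (by
    simp [inputStore, Store.setBlock, Store.setReal, Store.setNat])) h3 ?_
    ((hs₁.real 1 rfl).trans (by
      simp [inputStore, Store.setBlock, Store.setReal, Store.setNat])) fun i j => ?_)
    fun s₂ hs₂ ⟨hcols, h7⟩ => ?_
  · ext i j
    rw [readBlock, of_apply, hs₁.arr 0 rfl, hA₀]
  · rw [hs₁.arr 7 rfl, hz 7 i j (by norm_num)]
  refine Runs.seq (runs_samplingLoop hk₀ (by omega) hkr hV hE hcols h7 fun a => ?_)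
    fun s₃ hs₃ ⟨i, t, hst, hd⟩ => ?_
  · rw [hs₂.arr 11 rfl, hs₁.arr 11 rfl, hz 11 a 0 (by norm_num)]
  refine (runs_solve (A := A) (b := b) (by omega) (by omega)
    ((hs₃.nat 0 rfl).trans ((hs₂.nat 0 rfl).trans g0))
    ((hs₃.nat 1 rfl).trans ((hs₂.nat 1 rfl).trans g1)) (fun i j => ?_) (fun i => ?_) hd).imp
    fun s _ hx => ⟨_, _, ⟨i, t, hst, rfl, rfl⟩, ?_⟩
  · rw [hs₃.arr 0 rfl, hs₂.arr 0 rfl, hs₁.arr 0 rfl, hA₀]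
  · rw [hs₃.arr 1 rfl, hs₂.arr 1 rfl, hs₁.arr 1 rfl, hb₀]
  · rw [hx, mulVec_mulVec, output_eq A i fun τ hτ => (hst τ hτ).1]

/-- Rounding up costs at most one, and `1 ≤ k/ε²`. -/
theorem numCols_le {k : ℕ} (hk : 0 < k) {ε : ℝ} (hε : 0 < ε) (hε' : ε < 1 / 2) :
    (numCols k ε : ℝ) ≤ 10 * (k / ε ^ 2) := by
  have h1 := (Nat.ceil_lt_add_one (show 0 ≤ 9 * (k : ℝ) / ε ^ 2 by positivity)).le
  have h2 : 1 ≤ (k : ℝ) / ε ^ 2 := by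
    have : (1 : ℝ) ≤ k := by exact_mod_cast hk
    rw [le_div_iff₀ (by positivity)]
    nlinarith
  rw [mul_div_assoc] at h1
  rw [numCols, mul_div_assoc]
  linarith

end SparseRegression

theorem theorem1 :
    (∀ (m n k : ℕ) (A : Matrix (Fin m) (Fin n) ℝ) (b : Fin m → ℝ) (ε : ℝ) (D : CompactSVD A)
        (hk₀ : 0 < k) (hk : k < A.rank), 0 < ε → ε < 1 / 2 →
      (∀ (τ : ℕ) (i : ℕ → Fin n) (t : ℕ → ℝ), τ < numCols k ε →
        SamplingSteps (D.Vk hk.le)ᵀ (residualMatrix D hk.le) (numCols k ε) τ i t →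
        ∃ (i' : Fin n) (t' : ℝ), Admissible (D.Vk hk.le)ᵀ (residualMatrix D hk.le) (numCols k ε)
          (accum (D.Vk hk.le)ᵀ i t τ) τ i' t') ∧
      (∃ x : Fin n → ℝ, IsSparseRegressionOutput D b hk.le ε x) ∧
      ∀ x : Fin n → ℝ, IsSparseRegressionOutput D b hk.le ε x →
        (Finset.univ.filter fun j => x j ≠ 0).card ≤ ⌈9 * (k : ℝ) / ε ^ 2⌉₊ ∧
        l2norm (A *ᵥ x - b) ≤ l2norm (A *ᵥ (pinv (D.Ak hk.le) *ᵥ b) - b) +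
          (1 + ε) * l2norm b * (frobNorm (A - D.Ak hk.le) / D.s ⟨k - 1, by omega⟩)) ∧
    (∃ (P : Cmd) (c : ℝ), ∀ (svd : SVDRoutine) (m n k : ℕ) (A : Matrix (Fin m) (Fin n) ℝ)
        (b : Fin m → ℝ) (ε : ℝ) (_ : 0 < k) (hk : k < A.rank), 0 < ε → ε < 1 / 2 →
      ∃ (st : Store) (T : ℕ), Exec svd P (inputStore A b k ε) st T ∧
        IsSparseRegressionOutput (svd m n A) b hk.le ε (outputVector st n) ∧
        (T : ℝ) ≤ c * ((m : ℝ) * n * min (m : ℝ) n + n * (k : ℝ) ^ 3 / ε ^ 2)) := by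
  -- The constant is the `1200` of `runs_sparseRegression` times the `10` of `numCols_le`; it also
  -- exceeds the coefficient `300` of the other term.
  refine ⟨fun m n k A b ε D hk₀ hk hε hε' => ?_, sparseRegression, 12000,
    fun svd m n k A b ε hk₀ hk hε hε' => ?_⟩
  · obtain ⟨hkr, -⟩ := numCols_bound hk₀ hε hε'
    have hE := D.frobNorm_residualMatrix_ne_zero hk.le hk
    have hV : (D.Vk hk.le)ᵀ * (D.Vk hk.le)ᵀᵀ = 1 := by
      rw [transpose_transpose, D.Vk_orth]
    refine ⟨fun τ i t _ h => (h.barrierInvariant hk₀ hkr).exists_admissible hk₀ hkr hV hE, ?_,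
      fun x hx => ⟨card_output_ne_zero_le hx, l2norm_output_sub_le D b hk₀ hk _ hε hε' hx⟩⟩
    have hn : 0 < n := (hk₀.trans hk).trans_le A.rank_le_width
    obtain ⟨i, t, h⟩ := exists_samplingSteps hk₀ hkr hV hE ⟨0, hn⟩ (numCols k ε)
    exact ⟨_, _, _, ⟨i, t, h, rfl, rfl⟩, rfl⟩
  · obtain ⟨s, T, hs, hT, hx⟩ := runs_sparseRegression svd A b hk₀ hk hε hε'
    refine ⟨s, T, hs, hx, ?_⟩
    have hT' : (T : ℝ) ≤ 300 * (m * n * min (m : ℝ) n) +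
        1200 * (numCols k ε * (n * ((k : ℝ) * k))) := by exact_mod_cast hT
    have h1 : (numCols k ε : ℝ) * (n * ((k : ℝ) * k)) ≤ 10 * (n * (k : ℝ) ^ 3 / ε ^ 2) := by
      calc _ ≤ 10 * (k / ε ^ 2) * (n * ((k : ℝ) * k)) :=
            mul_le_mul_of_nonneg_right (numCols_le hk₀ hε hε') (by positivity)
        _ = _ := by ring
    have h2 : 0 ≤ (m : ℝ) * n * min (m : ℝ) n := by positivity
    linarith
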